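/- An \textit{outerplanar (convex) drawing} of a finite graph $G$ places the vertices of $G$ at distinct points of a circle and draws each edge as the straight segment joining its ends, so that no more than two edges cross in a single point. The \textit{outerplanar crossing number} $\nu_1(G)$ is the minimum number of crossings (pairs of edges that cross) over all outerplanar drawings of $G$. Let $K(p^{(1)},m^{(n)})$ denote the complete multipartite graph with one partite set of size $p$ and $n$ partite sets of size $m$. \textbf{Theorem.} If $p \mid mn$, then \begin{align*} \nu_1\bigl(K(p^{(1)},m^{(n)})\bigr)={}&\tfrac{1}{24}m^{4}n^{4}+\tfrac{1}{12}m^{2}n^{3}-\tfrac{1}{12}m^{4}n^{3}-\tfrac{1}{4}m^{3}n^{3}+\tfrac{1}{2}m^{3}n^{2}+\tfrac{1}{24}m^{4}n^{2}-\tfrac{1}{4}m^{3}n\\ &+\tfrac{1}{6}m^{2}n^{2}p^{2}-\tfrac{1}{4}p^{2}mn-\tfrac{3}{4}m^{2}n^{2}p+\tfrac{1}{12}mnp+\tfrac{1}{2}m^{2}np\\ &-\tfrac{1}{6}m^{3}n^{2}p+\tfrac{1}{6}m^{3}n^{3}p+\tfrac{1}{6}mn^{2}p. \end{align*} -/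

import Mathlib

/-- The complete multipartite graph `K(a^(s), b^(t))`, with `s` partite sets of size `a` and
`t` partite sets of size `b`. -/
abbrev multipartiteK (a s b t : ℕ) :
    SimpleGraph (Σ i : Fin s ⊕ Fin t, Fin (Sum.elim (fun _ => a) (fun _ => b) i)) :=
  SimpleGraph.completeMultipartiteGraph
    (fun i : Fin s ⊕ Fin t => Fin (Sum.elim (fun _ => a) (fun _ => b) i))

/-- The relative interior of the straight segment that represents the edge `e` when the vertices
are placed in the plane by `pos`. -/
def edgeInterior {V : Type*} (pos : V → Circle) (e : Sym2 V) : Set ℂ :=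
  {z | ∃ u v : V, e = s(u, v) ∧ z ∈ openSegment ℝ (pos u : ℂ) (pos v : ℂ)}

/-- An outerplanar (convex) drawing of `G`: the vertices are distinct points of the unit circle,
the edges are the straight segments between their ends, and no more than two edges cross in a
single point. -/
structure OuterplanarDrawing {V : Type*} (G : SimpleGraph V) where
  /-- the position of each vertex on the circle -/
  pos : V → Circle
  pos_injective : Function.Injective pos
  not_three_concurrent : ∀ e ∈ G.edgeSet, ∀ f ∈ G.edgeSet, ∀ g ∈ G.edgeSet,
    e ≠ f → e ≠ g → f ≠ g →
      edgeInterior pos e ∩ edgeInterior pos f ∩ edgeInterior pos g = ∅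

/-- The crossings of a drawing: the unordered pairs of distinct edges whose interiors meet. -/
def OuterplanarDrawing.crossings {V : Type*} {G : SimpleGraph V} (D : OuterplanarDrawing G) :
    Set (Sym2 (Sym2 V)) :=
  {q | ∃ e ∈ G.edgeSet, ∃ f ∈ G.edgeSet, e ≠ f ∧ q = s(e, f) ∧
    (edgeInterior D.pos e ∩ edgeInterior D.pos f).Nonempty}

/-- The number of crossings of a drawing (of a finite graph). -/
noncomputable def OuterplanarDrawing.cr {V : Type*} {G : SimpleGraph V}
    (D : OuterplanarDrawing G) : ℕ :=
  D.crossings.ncard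

/-- The outerplanar crossing number of a finite graph: the minimum number of crossings over all
its outerplanar drawings. -/
noncomputable def outerplanarCrossingNumber {V : Type*} [Finite V] (G : SimpleGraph V) : ℕ :=
  sInf (Set.range fun D : OuterplanarDrawing G => D.cr)

/-! ### Sign functions of linear orders and of cut cyclic orders -/

/-- The sign of the difference of two keys. -/
def keySign {V R : Type*} [LinearOrder R] (κ : V → R) (x y : V) : ℤ :=
  if κ y < κ x then 1 else if κ x < κ y then -1 else 0

/-- `τ x y` behaves on `S` like the sign of `x - y` for a linear order. -/
structure IsOrderSign {V : Type*} [DecidableEq V] (τ : V → V → ℤ) (S : Finset V) : Prop where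
  anti : ∀ x ∈ S, ∀ y ∈ S, τ y x = -τ x y
  tri : ∀ x ∈ S, ∀ y ∈ S, ∀ z ∈ S,
    τ x y * τ x z + τ y x * τ y z + τ z x * τ z y = if x = y ∧ y = z then 0 else 1

/-- The sign function of the linear order obtained by cutting a cyclic order at `v`. -/
def cutSign {V : Type*} (σ : V → V → ℤ) (v x y : V) : ℤ := σ v x * σ x y * σ y v

/-- The product of signs that is negative exactly if `x, y` separate `u, v`. -/
def sepProd {V : Type*} (σ : V → V → ℤ) (x y u v : V) : ℤ := σ x u * σ x v * σ y u * σ y v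

/-- The indicator of the event that `x, y` separate `u, v` in the cyclic order. -/
def sep {V : Type*} (σ : V → V → ℤ) (x y u v : V) : ℤ := if sepProd σ x y u v < 0 then 1 else 0

section OrderSign

variable {V R : Type*} [LinearOrder R]

theorem keySign_anti (κ : V → R) (x y : V) : keySign κ y x = -keySign κ x y := by
  unfold keySign
  rcases lt_trichotomy (κ x) (κ y) with h | h | h
  · simp [h, h.not_gt]
  · simp [h]
  · simp [h, h.not_gt]

theorem keySign_of_lt {κ : V → R} {x y : V} (h : κ x < κ y) : keySign κ x y = -1 := by
  simp [keySign, h, h.not_gt]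

theorem keySign_of_gt {κ : V → R} {x y : V} (h : κ y < κ x) : keySign κ x y = 1 := by
  simp [keySign, h]

@[simp] theorem keySign_self (κ : V → R) (x : V) : keySign κ x x = 0 := by
  simp [keySign]

variable [DecidableEq V]

/-- Of three distinct points the two extremes have product of signs 1 and the middle one has -1,
which makes a total of 1; if just two coincide, only the third contributes. Antisymmetry and this
quadratic identity are all that the counting uses of an order. -/
theorem isOrderSign_keySign {κ : V → R} (hκ : κ.Injective) (S : Finset V) :
    IsOrderSign (keySign κ) S where
  anti x _ y _ := keySign_anti κ x y
  tri x _ y _ z _ := by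
    have h1 : x = y ↔ κ x = κ y := hκ.eq_iff.symm
    have h2 : y = z ↔ κ y = κ z := hκ.eq_iff.symm
    simp only [h1, h2]
    unfold keySign
    generalize κ x = a
    generalize κ y = b
    generalize κ z = c
    rcases lt_trichotomy a b with h | h | h <;> rcases lt_trichotomy b c with h' | h' | h' <;>
      rcases lt_trichotomy a c with h'' | h'' | h'' <;>
      first
      | (exfalso; order)
      | (simp [h, h', h'', h.not_gt, h'.not_gt, h''.not_gt] <;> intros <;> order)

theorem IsOrderSign.mono {τ : V → V → ℤ} {S T : Finset V} (h : IsOrderSign τ S) (hTS : T ⊆ S) :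
    IsOrderSign τ T where
  anti x hx y hy := h.anti x (hTS hx) y (hTS hy)
  tri x hx y hy z hz := h.tri x (hTS hx) y (hTS hy) z (hTS hz)

theorem IsOrderSign.self {τ : V → V → ℤ} {S : Finset V} (h : IsOrderSign τ S) {x : V}
    (hx : x ∈ S) : τ x x = 0 := by
  have := h.anti x hx x hx
  omega

theorem IsOrderSign.sq {τ : V → V → ℤ} {S : Finset V} (h : IsOrderSign τ S) {x y : V}
    (hx : x ∈ S) (hy : y ∈ S) : τ x y * τ x y = if x = y then 0 else 1 := by
  have h1 := h.tri x hx y hy y hy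
  have h2 := h.self hy
  rw [h2] at h1
  simpa using h1

theorem IsOrderSign.eq_one_or {τ : V → V → ℤ} {S : Finset V} (h : IsOrderSign τ S) {x y : V}
    (hx : x ∈ S) (hy : y ∈ S) (hxy : x ≠ y) : τ x y = 1 ∨ τ x y = -1 := by
  have := h.sq hx hy
  rw [if_neg hxy] at this
  exact mul_self_eq_one_iff.mp this

theorem cutSign_mul {σ : V → V → ℤ} {S : Finset V} (h : IsOrderSign σ S) {v x y z : V}
    (hv : v ∈ S) (hx : x ∈ S) (hxv : x ≠ v) :
    cutSign σ v x y * cutSign σ v x z = σ x y * σ x z * (σ y v * σ z v) := by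
  have h1 : σ v x * σ v x = 1 := by rw [h.sq hv hx, if_neg hxv.symm]
  unfold cutSign
  linear_combination (σ x y * σ y v * σ x z * σ z v) * h1

/-- The factor `σ v x * σ y v` is -1 if `x, y` lie on the same side of `v` and 1 otherwise. So the
part after `v` is moved in front of the part before it, and the resulting order is reversed as a
whole, which is harmless. -/
theorem isOrderSign_cutSign {σ : V → V → ℤ} {S T : Finset V} (h : IsOrderSign σ S) {v : V}
    (hv : v ∈ S) (hTS : T ⊆ S) (hvT : v ∉ T) : IsOrderSign (cutSign σ v) T where
  anti x hx y hy := by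
    unfold cutSign
    rw [h.anti x (hTS hx) y (hTS hy), h.anti v hv x (hTS hx), h.anti y (hTS hy) v hv]
    ring
  tri x hx y hy z hz := by
    have ne : ∀ w ∈ T, w ≠ v := fun w hw e => hvT (e ▸ hw)
    rw [cutSign_mul h hv (hTS hx) (ne x hx), cutSign_mul h hv (hTS hy) (ne y hy),
      cutSign_mul h hv (hTS hz) (ne z hz)]
    have t0 := h.tri x (hTS hx) y (hTS hy) z (hTS hz)
    have s : ∀ w ∈ T, σ w v * σ w v = 1 := fun w hw => by
      rw [h.sq (hTS hw) hv, if_neg (ne w hw)]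
    have sx := s x hx
    have sy := s y hy
    have sz := s z hz
    have t1 := h.tri x (hTS hx) y (hTS hy) v hv
    have t2 := h.tri y (hTS hy) z (hTS hz) v hv
    have t3 := h.tri x (hTS hx) z (hTS hz) v hv
    simp only [ne y hy, ne z hz, and_false, if_false] at t1 t2 t3
    rw [h.anti x (hTS hx) v hv, h.anti y (hTS hy) v hv] at t1
    rw [h.anti y (hTS hy) v hv, h.anti z (hTS hz) v hv] at t2
    rw [h.anti x (hTS hx) v hv, h.anti z (hTS hz) v hv] at t3
    by_cases e1 : x = y
    · subst e1
      have sx0 := h.self (hTS hx)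
      by_cases e2 : x = z
      · subst e2
        simp [sx0]
      · have := h.sq (hTS hz) (hTS hx)
        rw [if_neg (Ne.symm e2)] at this
        simp only [e2, and_false, if_false, sx0, zero_mul, zero_add, this, sx, one_mul]
    · by_cases e2 : y = z
      · subst e2
        have sy0 := h.self (hTS hy)
        have := h.sq (hTS hx) (hTS hy)
        rw [if_neg e1] at this
        simp only [e1, false_and, if_false, sy0, zero_mul, mul_zero, add_zero, this, sy, one_mul]
      · by_cases e3 : x = z
        · subst e3
          have := h.sq (hTS hy) (hTS hx)
          rw [if_neg (Ne.symm e1)] at this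
          simp only [e1, false_and, if_false, h.self (hTS hx), zero_mul, mul_zero, add_zero,
            zero_add, this, sx, one_mul]
        · simp only [e1, false_and, if_false] at t0 ⊢
          -- All four points are distinct here: a finite check of six signs, in which `t0`, …, `t3`
          -- rule out the sign patterns that no order has.
          rcases h.eq_one_or (hTS hx) (hTS hy) e1 with a | a <;>
          rcases h.eq_one_or (hTS hy) (hTS hz) e2 with b | b <;>
          rcases h.eq_one_or (hTS hx) (hTS hz) e3 with c | c <;>
          rcases h.eq_one_or (hTS hx) hv (ne x hx) with d | d <;>
          rcases h.eq_one_or (hTS hy) hv (ne y hy) with e | e <;>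
          rcases h.eq_one_or (hTS hz) hv (ne z hz) with f | f <;>
          simp [h.anti x (hTS hx) y (hTS hy), h.anti y (hTS hy) z (hTS hz),
            h.anti x (hTS hx) z (hTS hz), a, b, c, d, e, f] at t0 t1 t2 t3 ⊢

/-- The sum of the squares of the signed ranks. -/
theorem IsOrderSign.three_mul_sum_rank_sq {τ : V → V → ℤ} {A : Finset V} (h : IsOrderSign τ A) :
    3 * ∑ x ∈ A, (∑ y ∈ A, τ x y) ^ 2 = (A.card : ℤ) ^ 3 - A.card := by
  have e0 : ∑ x ∈ A, (∑ y ∈ A, τ x y) ^ 2 = ∑ x ∈ A, ∑ y ∈ A, ∑ z ∈ A, τ x y * τ x z := by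
    simp only [pow_two, Finset.sum_mul_sum]
  have e1 : ∑ x ∈ A, ∑ y ∈ A, ∑ z ∈ A, τ y x * τ y z =
      ∑ x ∈ A, ∑ y ∈ A, ∑ z ∈ A, τ x y * τ x z := by
    rw [Finset.sum_comm]
  have e2 : ∑ x ∈ A, ∑ y ∈ A, ∑ z ∈ A, τ z x * τ z y =
      ∑ x ∈ A, ∑ y ∈ A, ∑ z ∈ A, τ x y * τ x z := by
    rw [← e1]
    refine Finset.sum_congr rfl fun x _ => ?_
    rw [Finset.sum_comm]
  -- Summing `tri` over all triples: each contributes 1 except the `A.card` constant ones, and by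
  -- symmetry the three summands have equal totals.
  have e3 : ∑ x ∈ A, ∑ y ∈ A, ∑ z ∈ A,
      (τ x y * τ x z + τ y x * τ y z + τ z x * τ z y) = (A.card : ℤ) ^ 3 - A.card := by
    have : ∀ x ∈ A, ∑ y ∈ A, ∑ z ∈ A,
        (τ x y * τ x z + τ y x * τ y z + τ z x * τ z y) = (A.card : ℤ) ^ 2 - 1 := by
      intro x hx
      have : ∀ y ∈ A, ∑ z ∈ A, (τ x y * τ x z + τ y x * τ y z + τ z x * τ z y) =
          (A.card : ℤ) - if x = y then 1 else 0 := by
        intro y hy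
        have : ∀ z ∈ A, (τ x y * τ x z + τ y x * τ y z + τ z x * τ z y) =
            1 - if y = z then (if x = y then 1 else 0) else 0 := by
          intro z hz
          rw [h.tri x hx y hy z hz]
          by_cases a : x = y
          · by_cases b : y = z <;> simp [a, b]
          · simp [a]
        rw [Finset.sum_congr rfl this, Finset.sum_sub_distrib, Finset.sum_ite_eq]
        simp [hy]
      rw [Finset.sum_congr rfl this, Finset.sum_sub_distrib, Finset.sum_ite_eq]
      simp [hx, pow_two]
    rw [Finset.sum_congr rfl this]
    simp
    ring
  rw [e0]
  simp only [Finset.sum_add_distrib] at e3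
  rw [e1, e2] at e3
  linarith

end OrderSign

/-! ### Separating pairs seen from a fixed point -/

theorem sep_comm_left {V : Type*} (σ : V → V → ℤ) (x y u v : V) : sep σ x y u v = sep σ y x u v := by
  unfold sep sepProd
  congr 2
  ring

theorem sep_comm_right {V : Type*} (σ : V → V → ℤ) (x y u v : V) : sep σ x y u v = sep σ x y v u := by
  unfold sep sepProd
  congr 2
  ring

section Separation

variable {V : Type*} [DecidableEq V] [Fintype V] {σ : V → V → ℤ}

open Finset

theorem IsOrderSign.sepProd_swap (h : IsOrderSign σ univ) (x y u v : V) :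
    sepProd σ x y u v = sepProd σ u v x y := by
  unfold sepProd
  rw [h.anti x (mem_univ _) u (mem_univ _), h.anti x (mem_univ _) v (mem_univ _),
    h.anti y (mem_univ _) u (mem_univ _), h.anti y (mem_univ _) v (mem_univ _)]
  ring

theorem IsOrderSign.sep_swap (h : IsOrderSign σ univ) (x y u v : V) :
    sep σ x y u v = sep σ u v x y := by
  unfold sep
  rw [h.sepProd_swap]

theorem IsOrderSign.sep_eq_zero (h : IsOrderSign σ univ) {x y u v : V}
    (hne : x = y ∨ u = v ∨ x = u ∨ x = v ∨ y = u ∨ y = v) : sep σ x y u v = 0 := by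
  have self : ∀ x, σ x x = 0 := fun x => h.self (mem_univ x)
  unfold sep sepProd
  rw [if_neg]
  rcases hne with rfl | rfl | rfl | rfl | rfl | rfl
  · nlinarith [sq_nonneg (σ x u * σ x v)]
  · nlinarith [sq_nonneg (σ x u * σ y u)]
  all_goals simp [self]

theorem IsOrderSign.eq_zero_or (h : IsOrderSign σ univ) (x y : V) :
    σ x y = 0 ∨ σ x y = 1 ∨ σ x y = -1 := by
  by_cases e : x = y
  · subst e
    exact Or.inl (h.self (mem_univ _))
  · exact Or.inr (h.eq_one_or (mem_univ _) (mem_univ _) e)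

theorem IsOrderSign.two_mul_sep (h : IsOrderSign σ univ) (x y u v : V) :
    2 * sep σ x y u v = sepProd σ x y u v * sepProd σ x y u v - sepProd σ x y u v := by
  unfold sep sepProd
  rcases h.eq_zero_or x u with a | a | a <;> rcases h.eq_zero_or x v with b | b | b <;>
  rcases h.eq_zero_or y u with c | c | c <;> rcases h.eq_zero_or y v with d | d | d <;>
  simp [a, b, c, d]

/-- Turns separation into betweenness: `x, y` separate `u, v` exactly if `u` lies between `x` and
`y` after cutting at `v`. -/
theorem IsOrderSign.sepProd_eq_cutSign (h : IsOrderSign σ univ) {x y u v : V} (huv : u ≠ v) :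
    sepProd σ x y u v = cutSign σ v u x * cutSign σ v u y := by
  rw [cutSign_mul h (mem_univ _) (mem_univ _) huv]
  unfold sepProd
  rw [h.anti u (mem_univ _) x (mem_univ _), h.anti u (mem_univ _) y (mem_univ _)]
  ring

/-- The number of pairs in `A` that separate `v` from a point of `B`, ordered pairs being counted. -/
def sepCount (σ : V → V → ℤ) (v : V) (A B : Finset V) : ℤ :=
  ∑ u ∈ B, ∑ x ∈ A, ∑ y ∈ A, sep σ x y u v

/-- Among `N` signs with sum `s`, the ordered pairs of opposite signs number `(N ^ 2 - s ^ 2) / 2`.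
Here the signs are those of `u` against `A`; if `u ∈ A`, its own sign is 0, hence the `erase`. -/
theorem IsOrderSign.two_mul_sepCount (h : IsOrderSign σ univ) {v : V} {A B : Finset V}
    (hA : v ∉ A) (hB : v ∉ B) :
    2 * sepCount σ v A B =
      ∑ u ∈ B, (((A.erase u).card : ℤ) ^ 2 - (∑ x ∈ A, cutSign σ v u x) ^ 2) := by
  unfold sepCount
  rw [mul_sum]
  refine sum_congr rfl fun u hu => ?_
  have huv : u ≠ v := fun e => hB (e ▸ hu)
  have hc := isOrderSign_cutSign (T := univ.erase v) h (mem_univ v) (subset_univ _)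
    (notMem_erase _ _)
  have hsq : ∀ x ∈ A, cutSign σ v u x * cutSign σ v u x = if u = x then 0 else 1 := by
    intro x hx
    exact hc.sq (by simp [huv]) (by simp; exact fun e => hA (e ▸ hx))
  have hcard : ((A.erase u).card : ℤ) = ∑ x ∈ A, cutSign σ v u x * cutSign σ v u x := by
    rw [sum_congr rfl hsq, card_eq_sum_ones, Nat.cast_sum, ← filter_ne, sum_filter]
    refine sum_congr rfl fun x _ => ?_
    by_cases e : u = x <;> simp [e]
  rw [hcard, pow_two, pow_two, sum_mul_sum, sum_mul_sum, mul_sum, ← sum_sub_distrib]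
  refine sum_congr rfl fun x _ => ?_
  rw [mul_sum, ← sum_sub_distrib]
  refine sum_congr rfl fun y _ => ?_
  rw [h.two_mul_sep, h.sepProd_eq_cutSign huv]
  ring

/-- After the cut each triple of `A` has exactly one middle point and so contributes 2, whatever the
order. -/
theorem IsOrderSign.three_mul_sepCount_self (h : IsOrderSign σ univ) {v : V} {A : Finset V}
    (hA : v ∉ A) :
    3 * sepCount σ v A A = (A.card : ℤ) * (A.card - 1) * (A.card - 2) := by
  have h1 := h.two_mul_sepCount hA hA
  have hc := isOrderSign_cutSign (T := A) h (mem_univ v) (subset_univ _) hA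
  have h2 := hc.three_mul_sum_rank_sq
  have h3 : ∑ u ∈ A, ((A.erase u).card : ℤ) ^ 2 = A.card * (A.card - 1) ^ 2 := by
    rw [sum_congr rfl (g := fun _ => ((A.card : ℤ) - 1) ^ 2)]
    · simp
    · intro u hu
      rw [cast_card_erase_of_mem hu]
  rw [sum_sub_distrib, h3] at h1
  linarith

/-- Each set of four points has exactly one crossing pairing, counted 8 times among ordered tuples.
-/
theorem IsOrderSign.three_mul_sum_sep (h : IsOrderSign σ univ) (A : Finset V) :
    3 * ∑ v ∈ A, ∑ u ∈ A, ∑ x ∈ A, ∑ y ∈ A, sep σ x y u v =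
      (A.card : ℤ) * (A.card - 1) * (A.card - 2) * (A.card - 3) := by
  rw [mul_sum, sum_congr rfl
    (g := fun _ => ((A.card : ℤ) - 1) * (A.card - 2) * (A.card - 3))]
  · simp
    ring
  intro v hv
  have e : ∑ u ∈ A, ∑ x ∈ A, ∑ y ∈ A, sep σ x y u v = sepCount σ v (A.erase v) (A.erase v) := by
    unfold sepCount
    rw [← sum_erase A (a := v)]
    · refine sum_congr rfl fun u _ => ?_
      rw [← sum_erase A (a := v)]
      · refine sum_congr rfl fun x _ => ?_
        rw [← sum_erase A (a := v)]
        exact h.sep_eq_zero (by simp)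
      · exact sum_eq_zero fun y _ => h.sep_eq_zero (by simp)
    · exact sum_eq_zero fun x _ => sum_eq_zero fun y _ => h.sep_eq_zero (by simp)
  rw [e, h.three_mul_sepCount_self (notMem_erase _ _), cast_card_erase_of_mem hv]
  ring

/-- Cutting at `v`, the difference of the number of signs of `x` against `B` and against `A`. -/
def rankDefect (σ : V → V → ℤ) (v : V) (A B : Finset V) (x : V) : ℤ :=
  ∑ b ∈ B, cutSign σ v x b - ∑ a ∈ A, cutSign σ v x a

/-- Neither count alone is bounded well, but their sum completes a square: the cross terms of the
ranks in `A` and in `B` combine into `rankDefect`, and all else depends only on the common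
cardinality. -/
theorem IsOrderSign.sepCount_add_sepCount (h : IsOrderSign σ univ) {v : V} {A B : Finset V}
    (hA : v ∉ A) (hB : v ∉ B) (hAB : Disjoint A B) (hcard : A.card = B.card) :
    6 * (sepCount σ v A B + sepCount σ v B A) + 3 * ∑ x ∈ A, rankDefect σ v A B x ^ 2 =
      4 * (A.card : ℤ) ^ 3 - A.card := by
  have h1 := h.two_mul_sepCount hA hB
  have h2 := h.two_mul_sepCount hB hA
  have hc := isOrderSign_cutSign (T := A ∪ B) h (mem_univ v) (subset_univ _) (by simp [hA, hB])
  have hr := (hc.mono subset_union_left).three_mul_sum_rank_sq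
  rw [sum_sub_distrib, sum_congr rfl (g := fun _ => (A.card : ℤ) ^ 2)] at h1
  swap
  · intro u hu
    rw [erase_eq_of_notMem (disjoint_right.mp hAB hu)]
  rw [sum_sub_distrib, sum_congr rfl (g := fun _ => (A.card : ℤ) ^ 2)] at h2
  swap
  · intro u hu
    rw [erase_eq_of_notMem (disjoint_left.mp hAB hu), hcard]
  -- Summing `tri` over one point of `B` and two of `A` trades the squares at points of `B` for
  -- cross products at points of `A`.
  have key : ∑ u ∈ B, (∑ x ∈ A, cutSign σ v u x) ^ 2 = (A.card : ℤ) ^ 3 -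
      2 * ∑ x ∈ A, (∑ a ∈ A, cutSign σ v x a) * ∑ b ∈ B, cutSign σ v x b := by
    have : ∀ u ∈ B, (∑ x ∈ A, cutSign σ v u x) ^ 2 = (A.card : ℤ) ^ 2 -
        2 * ∑ x ∈ A, (∑ a ∈ A, cutSign σ v x a) * cutSign σ v x u := by
      intro u hu
      have hu' : u ∈ A ∪ B := mem_union_right _ hu
      have e1 : ∑ x ∈ A, ∑ y ∈ A, (cutSign σ v u x * cutSign σ v u y +
          cutSign σ v x u * cutSign σ v x y + cutSign σ v y u * cutSign σ v y x) =
          (A.card : ℤ) ^ 2 := by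
        rw [sum_congr rfl (g := fun _ => (A.card : ℤ))]
        · simp [pow_two]
        intro x hx
        rw [sum_congr rfl (g := fun _ => (1 : ℤ))]
        · simp
        intro y hy
        rw [hc.tri u hu' x (mem_union_left _ hx) y (mem_union_left _ hy), if_neg]
        rintro ⟨rfl, -⟩
        exact disjoint_left.mp hAB hx hu
      simp only [sum_add_distrib] at e1
      rw [sum_comm (f := fun x y => cutSign σ v y u * cutSign σ v y x), ← sum_mul_sum] at e1
      have e2 : ∑ x ∈ A, ∑ y ∈ A, cutSign σ v x u * cutSign σ v x y =
          ∑ x ∈ A, (∑ a ∈ A, cutSign σ v x a) * cutSign σ v x u := by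
        refine sum_congr rfl fun x _ => ?_
        rw [sum_mul]
        exact sum_congr rfl fun y _ => mul_comm _ _
      rw [e2] at e1
      linarith
    rw [sum_congr rfl this, sum_sub_distrib, ← mul_sum, sum_comm]
    simp only [sum_const, mul_sum, nsmul_eq_mul]
    rw [← hcard]
    ring
  have expand : ∑ x ∈ A, rankDefect σ v A B x ^ 2 = ∑ x ∈ A, (∑ b ∈ B, cutSign σ v x b) ^ 2 -
      2 * ∑ x ∈ A, (∑ a ∈ A, cutSign σ v x a) * ∑ b ∈ B, cutSign σ v x b +
      ∑ x ∈ A, (∑ a ∈ A, cutSign σ v x a) ^ 2 := by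
    rw [mul_sum, ← sum_sub_distrib, ← sum_add_distrib]
    refine sum_congr rfl fun x _ => ?_
    unfold rankDefect
    ring
  rw [key] at h1
  rw [expand]
  simp only [sum_const, nsmul_eq_mul, ← hcard] at h1 h2
  linarith

/-- Parity: `x` has one more nonzero sign against `B` than against `A`, so the defect is odd. -/
theorem IsOrderSign.one_le_rankDefect_sq (h : IsOrderSign σ univ) {v : V} {A B : Finset V}
    (hA : v ∉ A) (hB : v ∉ B) (hAB : Disjoint A B) (hcard : A.card = B.card) {x : V}
    (hx : x ∈ A) : 1 ≤ rankDefect σ v A B x ^ 2 := by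
  have hc := isOrderSign_cutSign (T := A ∪ B) h (mem_univ v) (subset_univ _) (by simp [hA, hB])
  have hx' : x ∈ A ∪ B := mem_union_left _ hx
  have odd : ∀ y ∈ A ∪ B, x ≠ y → (2 : ℤ) ∣ cutSign σ v x y - 1 := by
    intro y hy hxy
    rcases hc.eq_one_or hx' hy hxy with e | e <;> rw [e] <;> norm_num
  have d1 : (2 : ℤ) ∣ ∑ b ∈ B, (cutSign σ v x b - 1) := dvd_sum fun b hb =>
    odd b (mem_union_right _ hb) fun e => disjoint_left.mp hAB hx (e ▸ hb)
  have d2 : (2 : ℤ) ∣ ∑ a ∈ A.erase x, (cutSign σ v x a - 1) := dvd_sum fun a ha =>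
    odd a (mem_union_left _ (mem_of_mem_erase ha)) (ne_of_mem_erase ha).symm
  rw [sum_sub_distrib, sum_const, nsmul_eq_mul, mul_one] at d1 d2
  rw [sum_erase A (hc.self hx'), cast_card_erase_of_mem hx] at d2
  have hne : rankDefect σ v A B x ≠ 0 := by
    unfold rankDefect
    rw [hcard] at d2
    omega
  have := sq_pos_of_ne_zero hne
  omega

theorem IsOrderSign.sepCount_add_sepCount_le (h : IsOrderSign σ univ) {v : V} {A B : Finset V}
    (hA : v ∉ A) (hB : v ∉ B) (hAB : Disjoint A B) (hcard : A.card = B.card) :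
    3 * (sepCount σ v A B + sepCount σ v B A) ≤ 2 * ((A.card : ℤ) ^ 3 - A.card) := by
  have h1 := h.sepCount_add_sepCount hA hB hAB hcard
  have h2 : ∑ x ∈ A, (1 : ℤ) ≤ ∑ x ∈ A, rankDefect σ v A B x ^ 2 :=
    sum_le_sum fun x hx => h.one_le_rankDefect_sq hA hB hAB hcard hx
  simp only [sum_const, nsmul_eq_mul, mul_one] at h2
  linarith

/-- If, cutting at `v`, the points of `B` are matched to those of `A` so that the matched points
are separated by nothing in `A`, the bound `IsOrderSign.sepCount_add_sepCount_le` is attained. -/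
theorem IsOrderSign.sepCount_add_sepCount_eq (h : IsOrderSign σ univ) {v : V} {A B : Finset V}
    (hA : v ∉ A) (hB : v ∉ B) (hAB : Disjoint A B) (hcard : A.card = B.card) (β : V → V)
    (hβ : Set.BijOn β B A)
    (hcut : ∀ x ∈ A, ∀ b ∈ B, β b ≠ x → cutSign σ v x b = cutSign σ v x (β b)) :
    3 * (sepCount σ v A B + sepCount σ v B A) = 2 * ((A.card : ℤ) ^ 3 - A.card) := by
  have h1 := h.sepCount_add_sepCount hA hB hAB hcard
  have hc := isOrderSign_cutSign (T := A ∪ B) h (mem_univ v) (subset_univ _) (by simp [hA, hB])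
  have h2 : ∑ x ∈ A, rankDefect σ v A B x ^ 2 = ∑ x ∈ A, (1 : ℤ) := by
    refine sum_congr rfl fun x hx => ?_
    obtain ⟨b, hb, rfl⟩ := hβ.surjOn hx
    have hb : b ∈ B := hb
    have hx' : β b ∈ A ∪ B := mem_union_left _ hx
    have e : ∑ a ∈ A, cutSign σ v (β b) a = ∑ c ∈ B, cutSign σ v (β b) (β c) := by
      rw [← sum_image (f := fun a => cutSign σ v (β b) a) (g := β) hβ.injOn]
      congr 1
      exact_mod_cast hβ.image_eq.symm
    -- Matched terms cancel, except that `β b` has sign 0 against itself; the single sign that is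
    -- left makes the square equal to 1.
    have e2 : rankDefect σ v A B (β b) = cutSign σ v (β b) b := by
      unfold rankDefect
      rw [e, ← sum_sub_distrib, sum_eq_single b, hc.self hx', sub_zero]
      · intro c hc' hcb
        rw [hcut _ hx c hc' (fun e => hcb (hβ.injOn hc' hb e)), sub_self]
      · exact fun hb' => absurd hb hb'
    have hne : β b ≠ b := fun e => disjoint_left.mp hAB hx (by rwa [e])
    rw [e2, pow_two, hc.sq hx' (mem_union_right _ hb), if_neg hne]
  rw [h2] at h1
  simp only [sum_const, nsmul_eq_mul, mul_one] at h1
  linarith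

end Separation

/-! ### Mutual separation of two sets -/

section Balance

variable {V : Type*} [DecidableEq V] [Fintype V] {σ : V → V → ℤ}

open Finset

/-- The number of pairs of pairs from `A` and from `D` that separate each other, ordered pairs being
counted. -/
def mutualSepCount (σ : V → V → ℤ) (A D : Finset V) : ℤ :=
  ∑ x ∈ A, ∑ y ∈ A, ∑ u ∈ D, ∑ v ∈ D, sep σ x y u v

/-- The sum over `u ∈ D` of `1` or `-1` as `u` is outside or inside the interval from `x`
to `y`. -/
def signCorr (σ : V → V → ℤ) (D : Finset V) (x y : V) : ℤ := ∑ u ∈ D, σ x u * σ y u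

/-- The deviation of `signCorr σ D x y` from its value when each gap of `A` holds `q` points of
`D`. -/
def signCorrDefect (σ : V → V → ℤ) (q : ℤ) (A D : Finset V) (x y : V) : ℤ :=
  signCorr σ D x y - q * (signCorr σ A x y + if x = y then 1 else 0)

/-- For fixed `x, y` the set `D` is split into inside and outside points; `signCorr` is the
difference of their numbers, and its square measures how uneven the split is. -/
theorem IsOrderSign.two_mul_mutualSepCount (h : IsOrderSign σ univ) {A D : Finset V}
    (hAD : Disjoint A D) :
    2 * mutualSepCount σ A D = (A.card : ℤ) ^ 2 * (D.card : ℤ) ^ 2 -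
      ∑ x ∈ A, ∑ y ∈ A, signCorr σ D x y ^ 2 := by
  unfold mutualSepCount
  have hsq : ∀ x ∈ A, ∀ u ∈ D, σ x u * σ x u = 1 := fun x hx u hu => by
    rw [h.sq (mem_univ _) (mem_univ _), if_neg]
    rintro rfl
    exact disjoint_left.mp hAD hx hu
  have : ∀ x ∈ A, ∀ y ∈ A, 2 * ∑ u ∈ D, ∑ v ∈ D, sep σ x y u v =
      (D.card : ℤ) ^ 2 - signCorr σ D x y ^ 2 := by
    intro x hx y hy
    have e : ∀ u ∈ D, ∀ v ∈ D, 2 * sep σ x y u v = 1 - σ x u * σ y u * (σ x v * σ y v) := by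
      intro u hu v hv
      rw [h.two_mul_sep]
      unfold sepProd
      linear_combination σ x v * σ x v * σ y u * σ y u * σ y v * σ y v * hsq x hx u hu +
        σ y u * σ y u * σ y v * σ y v * hsq x hx v hv + σ y v * σ y v * hsq y hy u hu +
        hsq y hy v hv
    simp only [mul_sum]
    rw [sum_congr rfl fun u hu => sum_congr rfl fun v hv => e u hu v hv]
    simp only [sum_sub_distrib, ← sum_mul_sum, signCorr]
    simp [pow_two]
  rw [mul_sum, sum_congr rfl (g := fun x => (A.card : ℤ) * (D.card : ℤ) ^ 2 -
    ∑ y ∈ A, signCorr σ D x y ^ 2)]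
  · simp [pow_two, mul_assoc]
  intro x hx
  rw [mul_sum, sum_congr rfl (this x hx)]
  simp

/-- Exchanging the sums turns the left side into the sum of squared ranks of `A` cut at `u`, which
no order can change. -/
theorem IsOrderSign.sum_signCorr_mul (h : IsOrderSign σ univ) {A : Finset V} {u : V}
    (hu : u ∉ A) :
    3 * ∑ x ∈ A, ∑ y ∈ A, σ x u * σ y u * signCorr σ A x y = (A.card : ℤ) ^ 3 - A.card := by
  have hc := isOrderSign_cutSign (T := A) h (mem_univ u) (subset_univ _) hu
  rw [← hc.three_mul_sum_rank_sq]
  congr 1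
  simp only [signCorr, pow_two, sum_mul_sum]
  simp only [mul_sum]
  rw [sum_comm_cycle]
  refine sum_congr rfl fun z hz => sum_congr rfl fun x hx => sum_congr rfl fun y hy => ?_
  rw [cutSign_mul h (mem_univ _) (mem_univ _) (by rintro rfl; exact hu hz),
    h.anti x (mem_univ _) z (mem_univ _), h.anti y (mem_univ _) z (mem_univ _)]
  ring

theorem IsOrderSign.signCorr_self (h : IsOrderSign σ univ) {A : Finset V} {x : V} (hx : x ∈ A) :
    signCorr σ A x x = (A.card : ℤ) - 1 := by
  unfold signCorr
  rw [← cast_card_erase_of_mem hx, ← filter_ne, card_filter, Nat.cast_sum]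
  refine sum_congr rfl fun y _ => ?_
  rw [h.sq (mem_univ _) (mem_univ _)]
  by_cases e : x = y <;> simp [e]

theorem IsOrderSign.signCorr_self_of_notMem (h : IsOrderSign σ univ) {D : Finset V} {x : V}
    (hx : x ∉ D) : signCorr σ D x x = (D.card : ℤ) := by
  unfold signCorr
  rw [sum_congr rfl (g := fun _ => (1 : ℤ))]
  · simp
  · intro y hy
    rw [h.sq (mem_univ _) (mem_univ _), if_neg]
    rintro rfl
    exact hx hy

/-- One factor of the square is expanded over `w ∈ A`; the sum for each `w` is then the previous
lemma for `A.erase w`, plus the contribution of `w` itself. -/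
theorem IsOrderSign.three_mul_sum_signCorr_sq (h : IsOrderSign σ univ) (A : Finset V) :
    3 * ∑ x ∈ A, ∑ y ∈ A, signCorr σ A x y ^ 2 =
      (A.card : ℤ) * (3 * ((A.card : ℤ) - 1) ^ 2 + ((A.card - 1) ^ 3 - (A.card - 1))) := by
  have e : ∑ x ∈ A, ∑ y ∈ A, signCorr σ A x y ^ 2 =
      ∑ w ∈ A, ∑ x ∈ A, ∑ y ∈ A, σ x w * σ y w * signCorr σ A x y := by
    refine Eq.trans ?_ sum_comm_cycle
    refine sum_congr rfl fun x _ => ?_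
    refine sum_congr rfl fun y _ => ?_
    rw [← sum_mul]
    unfold signCorr
    ring
  rw [e, mul_sum, sum_congr rfl (g := fun _ =>
    (3 * ((A.card : ℤ) - 1) ^ 2 + ((A.card - 1) ^ 3 - (A.card - 1))))]
  · simp
  intro w hw
  have self := h.self (mem_univ w)
  have e1 : ∑ x ∈ A, ∑ y ∈ A, σ x w * σ y w * signCorr σ A x y =
      ∑ x ∈ A.erase w, ∑ y ∈ A.erase w, σ x w * σ y w * signCorr σ (A.erase w) x y +
      (signCorr σ A w w) ^ 2 := by
    have e2 : ∑ x ∈ A, ∑ y ∈ A, σ x w * σ y w * signCorr σ A x y =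
        ∑ x ∈ A, ∑ y ∈ A, σ x w * σ y w * signCorr σ (A.erase w) x y +
        ∑ x ∈ A, ∑ y ∈ A, (σ x w * σ x w) * (σ y w * σ y w) := by
      simp only [← sum_add_distrib]
      refine sum_congr rfl fun x _ => sum_congr rfl fun y _ => ?_
      unfold signCorr
      rw [← add_sum_erase A _ hw]
      ring
    rw [e2, ← sum_mul_sum, ← pow_two]
    congr 1
    · rw [← sum_erase A (a := w)]
      · refine sum_congr rfl fun x _ => ?_
        rw [← sum_erase A (a := w)]
        simp [self]
      · simp [self]
    · congr 1
      unfold signCorr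
      refine sum_congr rfl fun x _ => ?_
      rw [h.anti x (mem_univ _) w (mem_univ _)]
      ring
  rw [e1, h.signCorr_self hw, mul_add, h.sum_signCorr_mul (notMem_erase _ _),
    cast_card_erase_of_mem hw]
  ring

/-- In the expanded square of the defect, every term except the sum of `signCorr σ D x y ^ 2` is
independent of the order. So the count is a constant minus a sum of squares that vanishes for the
balanced distribution. -/
theorem IsOrderSign.mutualSepCount_add (h : IsOrderSign σ univ) {A D : Finset V} {q : ℤ}
    (hAD : Disjoint A D) (hq : (D.card : ℤ) = q * A.card) :
    6 * mutualSepCount σ A D + 3 * ∑ x ∈ A, ∑ y ∈ A, signCorrDefect σ q A D x y ^ 2 =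
      2 * (D.card : ℤ) ^ 2 * ((A.card : ℤ) ^ 2 - 1) := by
  have h1 := h.two_mul_mutualSepCount hAD
  have h2 := h.three_mul_sum_signCorr_sq A
  have h3 : 3 * ∑ x ∈ A, ∑ y ∈ A, signCorr σ D x y * signCorr σ A x y =
      (D.card : ℤ) * ((A.card : ℤ) ^ 3 - A.card) := by
    have : ∑ x ∈ A, ∑ y ∈ A, signCorr σ D x y * signCorr σ A x y =
        ∑ u ∈ D, ∑ x ∈ A, ∑ y ∈ A, σ x u * σ y u * signCorr σ A x y := by
      refine Eq.trans ?_ sum_comm_cycle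
      refine sum_congr rfl fun x _ => sum_congr rfl fun y _ => ?_
      rw [← sum_mul]
      rfl
    rw [this, mul_sum, sum_congr rfl fun u hu =>
      h.sum_signCorr_mul (disjoint_right.mp hAD hu)]
    rw [sum_const, nsmul_eq_mul]
  have h4 : ∑ x ∈ A, ∑ y ∈ A, (signCorr σ D x y * if x = y then 1 else 0) =
      (A.card : ℤ) * D.card := by
    rw [sum_congr rfl (g := fun _ => (D.card : ℤ))]
    · simp
    · intro x hx
      simp only [mul_ite, mul_one, mul_zero, sum_ite_eq, hx, if_true]
      exact h.signCorr_self_of_notMem (disjoint_left.mp hAD hx)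
  have h5 : ∑ x ∈ A, ∑ y ∈ A, (signCorr σ A x y * if x = y then 1 else 0) =
      (A.card : ℤ) * (A.card - 1) := by
    rw [sum_congr rfl (g := fun _ => (A.card : ℤ) - 1)]
    · rw [sum_const, nsmul_eq_mul]
    · intro x hx
      simp only [mul_ite, mul_one, mul_zero, sum_ite_eq, hx, if_true]
      exact h.signCorr_self hx
  have h6 : ∑ x ∈ A, ∑ y ∈ A, (if x = y then (1 : ℤ) else 0) = A.card := by
    rw [sum_congr rfl (g := fun _ => (1 : ℤ))]
    · simp
    · intro x hx
      simp [hx]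
  have expand : ∑ x ∈ A, ∑ y ∈ A, signCorrDefect σ q A D x y ^ 2 =
      ∑ x ∈ A, ∑ y ∈ A, signCorr σ D x y ^ 2
      - 2 * q * ∑ x ∈ A, ∑ y ∈ A, signCorr σ D x y * signCorr σ A x y
      - 2 * q * ∑ x ∈ A, ∑ y ∈ A, (signCorr σ D x y * if x = y then 1 else 0)
      + q ^ 2 * ∑ x ∈ A, ∑ y ∈ A, signCorr σ A x y ^ 2
      + 2 * q ^ 2 * ∑ x ∈ A, ∑ y ∈ A, (signCorr σ A x y * if x = y then 1 else 0)
      + q ^ 2 * ∑ x ∈ A, ∑ y ∈ A, (if x = y then (1 : ℤ) else 0) := by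
    simp only [mul_sum, ← sum_sub_distrib, ← sum_add_distrib]
    refine sum_congr rfl fun x _ => sum_congr rfl fun y _ => ?_
    unfold signCorrDefect
    split_ifs <;> ring
  rw [expand, h4, h5, h6]
  rw [hq] at h1 h3 ⊢
  linear_combination 3 * h1 + q ^ 2 * h2 - 2 * q * h3

theorem IsOrderSign.mutualSepCount_le (h : IsOrderSign σ univ) {A D : Finset V} {q : ℤ}
    (hAD : Disjoint A D) (hq : (D.card : ℤ) = q * A.card) :
    3 * mutualSepCount σ A D ≤ (D.card : ℤ) ^ 2 * ((A.card : ℤ) ^ 2 - 1) := by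
  have h1 := h.mutualSepCount_add hAD hq
  have : 0 ≤ ∑ x ∈ A, ∑ y ∈ A, signCorrDefect σ q A D x y ^ 2 :=
    sum_nonneg fun x _ => sum_nonneg fun y _ => sq_nonneg _
  linarith

/-- If the points of `D` are grouped into blocks of `q` points that follow (`ε = -1`) or precede
(`ε = 1`) the points of `A` immediately, the bound `IsOrderSign.mutualSepCount_le` is attained. -/
theorem IsOrderSign.mutualSepCount_eq (h : IsOrderSign σ univ) {A D : Finset V} {q : ℕ} {ε : ℤ}
    (hAD : Disjoint A D) (β : V → V) (hβ : ∀ u ∈ D, β u ∈ A)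
    (hq : ∀ a ∈ A, (D.filter fun u => β u = a).card = q)
    (hε : ∀ u ∈ D, σ (β u) u = ε)
    (hσ : ∀ x ∈ A, ∀ u ∈ D, β u ≠ x → σ x u = σ x (β u)) :
    3 * mutualSepCount σ A D = (D.card : ℤ) ^ 2 * ((A.card : ℤ) ^ 2 - 1) := by
  have hcard : (D.card : ℤ) = (q : ℤ) * A.card := by
    rw [card_eq_sum_card_fiberwise (f := β) (t := A) hβ, sum_congr rfl hq]
    simp [mul_comm]
  have h1 := h.mutualSepCount_add hAD hcard
  have h2 : ∑ x ∈ A, ∑ y ∈ A, signCorrDefect σ q A D x y ^ 2 = 0 := by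
    refine sum_eq_zero fun x hx => sum_eq_zero fun y hy => ?_
    have hε2 : ∀ u ∈ D, ε * ε = 1 := fun u hu => by
      rw [← hε u hu, h.sq (mem_univ _) (mem_univ _), if_neg]
      intro e
      exact disjoint_left.mp hAD (hβ u hu) (by rwa [e])
    -- A point `u` is seen from `A` like its block leader `β u`, except by the leader itself, which
    -- sees the sign `ε` in place of 0.
    have e1 : signCorr σ D x y = ∑ u ∈ D,
        (σ x (β u) + if β u = x then ε else 0) * (σ y (β u) + if β u = y then ε else 0) := by
      refine sum_congr rfl fun u hu => ?_
      have : ∀ x ∈ A, σ x u = σ x (β u) + if β u = x then ε else 0 := by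
        intro x hx
        split_ifs with e
        · rw [← e, h.self (mem_univ _), hε u hu, zero_add]
        · rw [hσ x hx u hu e, add_zero]
      rw [this x hx, this y hy]
    have e2 : signCorr σ D x y = q * ∑ a ∈ A,
        (σ x a + if a = x then ε else 0) * (σ y a + if a = y then ε else 0) := by
      rw [e1, ← sum_fiberwise_of_maps_to hβ, mul_sum]
      refine sum_congr rfl fun a ha => ?_
      rw [sum_congr rfl (g := fun _ =>
        (σ x a + if a = x then ε else 0) * (σ y a + if a = y then ε else 0)), sum_const, hq a ha,
        nsmul_eq_mul]
      intro u hu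
      rw [(mem_filter.mp hu).2]
    -- The mixed terms are `ε * σ y x` and `ε * σ x y`, which cancel by antisymmetry.
    have e3 : ∑ a ∈ A, (σ x a + if a = x then ε else 0) * (σ y a + if a = y then ε else 0) =
        signCorr σ A x y + if x = y then ε * ε else 0 := by
      simp only [add_mul, mul_add, sum_add_distrib, ite_mul, mul_ite, zero_mul, mul_zero,
        sum_ite_eq', hx, hy, if_true]
      rw [h.anti x (mem_univ _) y (mem_univ _)]
      unfold signCorr
      by_cases e : x = y
      · simp [e]
        ring
      · simp [e, Ne.symm e]
        ring
    unfold signCorrDefect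
    rw [e2, e3]
    by_cases e : x = y
    · rcases D.eq_empty_or_nonempty with hD | ⟨u, hu⟩
      · have : q = 0 := by
          rw [← hq x hx, hD]
          simp
        simp [this]
      · simp [e, hε2 u hu]
    · simp [e]
  rw [h2] at h1
  linarith

end Balance

/-! ### Classification of separating pairs by colours -/

section ColoredCount

open Finset

variable {V ι : Type*} [Fintype V] {σ : V → V → ℤ}

/-- The sum over all pairs `x, y` that separate a pair `u, v` of a weight that depends on the
colours. -/
def sepSum (σ : V → V → ℤ) (col : V → ι) (f : ι → ι → ι → ι → ℤ) : ℤ :=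
  ∑ v, ∑ u, ∑ x, ∑ y, sep σ x y u v * f (col x) (col y) (col u) (col v)

theorem sepSum_add (col : V → ι) (f g : ι → ι → ι → ι → ℤ) :
    sepSum σ col (fun a b c d => f a b c d + g a b c d) = sepSum σ col f + sepSum σ col g := by
  simp only [sepSum, mul_add, sum_add_distrib]

theorem sepSum_mul_left (col : V → ι) (k : ℤ) (f : ι → ι → ι → ι → ℤ) :
    sepSum σ col (fun a b c d => k * f a b c d) = k * sepSum σ col f := by
  simp only [sepSum, mul_sum]
  refine sum_congr rfl fun v _ => sum_congr rfl fun u _ => sum_congr rfl fun x _ =>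
    sum_congr rfl fun y _ => by ring

theorem sepSum_comm_left (col : V → ι) (f : ι → ι → ι → ι → ℤ) :
    sepSum σ col (fun a b c d => f b a c d) = sepSum σ col f := by
  unfold sepSum
  refine sum_congr rfl fun v _ => sum_congr rfl fun u _ => ?_
  rw [sum_comm]
  refine sum_congr rfl fun x _ => sum_congr rfl fun y _ => ?_
  rw [sep_comm_left]

theorem sepSum_comm_right (col : V → ι) (f : ι → ι → ι → ι → ℤ) :
    sepSum σ col (fun a b c d => f a b d c) = sepSum σ col f := by
  unfold sepSum
  rw [sum_comm]
  refine sum_congr rfl fun x _ => sum_congr rfl fun y _ => ?_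
  refine sum_congr rfl fun u _ => sum_congr rfl fun v _ => ?_
  rw [sep_comm_right]

theorem sum_swap_pairs (f : V → V → V → V → ℤ) :
    ∑ v, ∑ u, ∑ x, ∑ y, f v u x y = ∑ v, ∑ u, ∑ x, ∑ y, f x y v u := by
  have := sum_comm (s := univ) (t := univ) (f := fun p q : V × V => f p.1 p.2 q.1 q.2)
  simpa only [Fintype.sum_prod_type] using this

theorem IsOrderSign.sepSum_swap [DecidableEq V] (h : IsOrderSign σ univ) (col : V → ι)
    (f : ι → ι → ι → ι → ℤ) :
    sepSum σ col (fun a b c d => f c d a b) = sepSum σ col f := by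
  rw [← sepSum_comm_left col f, ← sepSum_comm_right col (fun a b c d => f b a c d)]
  unfold sepSum
  rw [sum_swap_pairs]
  refine sum_congr rfl fun x _ => sum_congr rfl fun y _ => ?_
  refine sum_congr rfl fun u _ => sum_congr rfl fun v _ => ?_
  rw [h.sep_swap, sep_comm_left, sep_comm_right]

variable [DecidableEq ι]

/-- The points of colour `i`. -/
def colorClass (col : V → ι) (i : ι) : Finset V := univ.filter fun x => col x = i

/-- The indicator of a proposition, as an integer. -/
abbrev indic (P : Prop) [Decidable P] : ℤ := if P then 1 else 0

/-- The weight in `color_decomposition` of the patterns in which `x, y` have the same colour and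
the colours of `u` and `v` are different from it and from each other. -/
def mixedWeight (o a b c d : ι) : ℤ :=
  (if d = o then 2 else 1) * indic (a = b ∧ a ≠ o ∧ c ≠ o ∧ c ≠ a ∧ d ≠ a ∧ c ≠ d)

/-- A partition of all colour patterns, doubled. A pattern with `a = b ≠ o` and two other distinct
colours `c, d` is shared equally by its two possible base points; if one of these is special, it
takes the full weight 2, so that the two remaining classes are always of equal size. Patterns with
`a = b = o` and `c, d` outside `o` stay together, whether or not `c = d`. -/
theorem color_decomposition (o a b c d : ι) :
    2 = 2 * indic (a ≠ b ∧ c ≠ d) + 2 * indic (a = b ∧ a = c ∧ a = d)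
      + 2 * indic (a = b ∧ a = c ∧ a ≠ d) + 2 * indic (a = b ∧ a = d ∧ a ≠ c)
      + 2 * indic (c = d ∧ c = a ∧ c ≠ b) + 2 * indic (c = d ∧ c = b ∧ c ≠ a)
      + 2 * indic (a = o ∧ b = o ∧ c ≠ o ∧ d ≠ o) + 2 * indic (c = o ∧ d = o ∧ a ≠ o ∧ b ≠ o)
      + 2 * indic (a = b ∧ c = d ∧ a ≠ o ∧ c ≠ o ∧ a ≠ c)
      + mixedWeight o a b c d + mixedWeight o a b d c
      + mixedWeight o c d a b + mixedWeight o c d b a := by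
  unfold mixedWeight
  by_cases ab : a = b
  · subst ab
    by_cases cd : c = d
    · subst cd
      by_cases ac : a = c
      · subst ac
        by_cases ao : a = o <;> simp [ao]
      · by_cases ao : a = o
        · subst ao
          simp [ac, Ne.symm ac]
        · by_cases co : c = o <;> simp [ac, Ne.symm ac, ao, co]
    · by_cases ac : a = c
      · subst ac
        by_cases ao : a = o
        · subst ao
          simp [cd, Ne.symm cd]
        · by_cases d_o : d = o <;> simp [cd, Ne.symm cd, ao, d_o]
      · by_cases ad : a = d
        · subst ad
          by_cases ao : a = o
          · subst ao
            simp [cd, Ne.symm cd]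
          · by_cases co : c = o <;> simp [cd, Ne.symm cd, ao, co]
        · by_cases ao : a = o
          · subst ao
            simp [cd, ac, ad, Ne.symm ac, Ne.symm ad]
          · by_cases co : c = o
            · subst co
              simp [cd, ac, ad, Ne.symm ac, Ne.symm ad, Ne.symm cd]
            · by_cases d_o : d = o
              · subst d_o
                simp [cd, ac, ad, Ne.symm ac, Ne.symm ad, Ne.symm cd]
              · simp [cd, ac, ad, Ne.symm ac, Ne.symm ad, Ne.symm cd, ao, co, d_o]
  · by_cases cd : c = d
    · subst cd
      by_cases ac : a = c
      · subst ac
        by_cases ao : a = o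
        · subst ao
          simp [ab, Ne.symm ab]
        · by_cases bo : b = o <;> simp [ab, Ne.symm ab, ao, bo]
      · by_cases bc : b = c
        · subst bc
          by_cases bo : b = o
          · subst bo
            simp [ab, Ne.symm ab]
          · by_cases ao : a = o
            · subst ao
              simp [ab, Ne.symm ab]
            · simp [ab, Ne.symm ab, ao, bo]
        · by_cases co : c = o
          · subst co
            simp [ab, ac, bc, Ne.symm ac, Ne.symm bc]
          · by_cases ao : a = o
            · subst ao
              simp [ab, ac, bc, Ne.symm ac, Ne.symm bc, Ne.symm ab]
            · by_cases bo : b = o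
              · subst bo
                simp [ab, ac, bc, Ne.symm ac, Ne.symm bc, Ne.symm ab]
              · simp [ab, ac, bc, Ne.symm ac, Ne.symm bc, Ne.symm ab, ao, co, bo]
    · have h1 : ¬(a = o ∧ b = o ∧ c ≠ o ∧ d ≠ o) := fun e => ab (e.1.trans e.2.1.symm)
      have h2 : ¬(c = o ∧ d = o ∧ a ≠ o ∧ b ≠ o) := fun e => cd (e.1.trans e.2.1.symm)
      simp only [indic, if_neg h1, if_neg h2]
      simp [ab, cd]

end ColoredCount

/-! ### Coloured counts as sums over classes -/

section ColoredBound

open Finset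

variable {V ι : Type*} {σ : V → V → ℤ}

theorem mutualSepCount_eq_sum_sepCount (A D : Finset V) :
    mutualSepCount σ A D = ∑ v ∈ D, sepCount σ v A D := by
  unfold mutualSepCount sepCount
  symm
  calc _ = ∑ v ∈ D, ∑ x ∈ A, ∑ y ∈ A, ∑ u ∈ D, sep σ x y u v :=
        sum_congr rfl fun v _ => (sum_comm_cycle).symm
    _ = _ := by
      rw [← sum_comm_cycle]
      refine sum_congr rfl fun x _ => sum_congr rfl fun y _ => sum_comm

theorem sum_indic_pair [DecidableEq ι] (J : Finset (ι × ι)) (a b c : ι) :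
    ∑ p ∈ J, indic (a = p.1 ∧ b = p.1 ∧ c = p.2) = indic (a = b ∧ (a, c) ∈ J) := by
  by_cases e : a = b
  · subst e
    have : ∀ p ∈ J, indic (a = p.1 ∧ a = p.1 ∧ c = p.2) = if (a, c) = p then 1 else 0 := by
      intro p _
      simp [indic, Prod.ext_iff]
    rw [sum_congr rfl this, sum_ite_eq]
    simp
  · simp only [indic, e, false_and, if_false]
    refine sum_eq_zero fun p _ => if_neg ?_
    rintro ⟨h1, h2, -⟩
    exact e (h1.trans h2.symm)

variable [Fintype V] [DecidableEq ι]

/-- The weight that counts the pairs of properly coloured pairs. -/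
def properSepSum (σ : V → V → ℤ) (col : V → ι) : ℤ :=
  sepSum σ col fun a b c d => indic (a ≠ b ∧ c ≠ d)

theorem sepCount_colorClass (col : V → ι) (v : V) (i j : ι) :
    sepCount σ v (colorClass col i) (colorClass col j) =
      ∑ u, ∑ x, ∑ y, sep σ x y u v * indic (col x = i ∧ col y = i ∧ col u = j) := by
  simp only [sepCount, colorClass, sum_filter]
  refine sum_congr rfl fun u _ => ?_
  by_cases hu : col u = j
  · simp only [hu, and_true, if_true]
    refine sum_congr rfl fun x _ => ?_
    by_cases hx : col x = i
    · simp [hx]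
    · simp [hx]
  · simp [hu]

theorem sum_sepCount_colorClass (col : V → ι) (v : V) (J : Finset (ι × ι)) :
    ∑ p ∈ J, sepCount σ v (colorClass col p.1) (colorClass col p.2) =
      ∑ u, ∑ x, ∑ y, sep σ x y u v * indic (col x = col y ∧ (col x, col u) ∈ J) := by
  simp only [sepCount_colorClass]
  rw [sum_comm]
  refine sum_congr rfl fun u _ => ?_
  rw [sum_comm]
  refine sum_congr rfl fun x _ => ?_
  rw [sum_comm]
  refine sum_congr rfl fun y _ => ?_
  rw [← mul_sum, sum_indic_pair]

theorem sepSum_eq_sum_mutualSepCount (col : V → ι) (J : Finset (ι × ι)) :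
    sepSum σ col (fun a b c d => indic (a = b ∧ c = d ∧ (a, c) ∈ J)) =
      ∑ p ∈ J, mutualSepCount σ (colorClass col p.1) (colorClass col p.2) := by
  have : ∀ p ∈ J, mutualSepCount σ (colorClass col p.1) (colorClass col p.2) =
      ∑ v, if p.2 = col v then sepCount σ v (colorClass col p.1) (colorClass col p.2)
        else 0 := by
    intro p _
    rw [mutualSepCount_eq_sum_sepCount]
    conv_lhs => rw [colorClass, sum_filter]
    refine sum_congr rfl fun v _ => ?_
    simp only [eq_comm, colorClass]
  rw [sum_congr rfl this, sum_comm]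
  unfold sepSum
  refine sum_congr rfl fun v _ => ?_
  rw [← sum_filter, sum_sepCount_colorClass]
  refine sum_congr rfl fun u _ => sum_congr rfl fun x _ => sum_congr rfl fun y _ => ?_
  congr 1
  simp only [indic, mem_filter]
  congr 1
  ext
  tauto

theorem sepSum_eq_mutualSepCount (col : V → ι) (o : ι) :
    sepSum σ col (fun a b c d => indic (a = o ∧ b = o ∧ c ≠ o ∧ d ≠ o)) =
      mutualSepCount σ (colorClass col o) (univ.filter fun x => col x ≠ o) := by
  rw [mutualSepCount_eq_sum_sepCount, sum_filter]
  refine sum_congr rfl fun v _ => ?_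
  simp only [sepCount, colorClass, sum_filter]
  by_cases hv : col v = o
  · simp [hv]
  · simp only [ne_eq, hv, not_false_eq_true, and_true, if_true]
    refine sum_congr rfl fun u _ => ?_
    by_cases hu : col u = o
    · simp [hu]
    · simp only [hu, not_false_eq_true, and_true, if_true]
      refine sum_congr rfl fun x _ => ?_
      by_cases hx : col x = o <;> simp [hx]

variable [Fintype ι]

/-- The index pairs of the patterns counted by `mixedWeight`, for a fourth point of colour `d`. -/
def mixedPairs (o d : ι) : Finset (ι × ι) := ((univ.erase o).erase d).offDiag

theorem sepSum_mixedWeight (col : V → ι) (o : ι) :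
    sepSum σ col (mixedWeight o) = ∑ v, (if col v = o then 2 else 1) *
      ∑ p ∈ mixedPairs o (col v), sepCount σ v (colorClass col p.1) (colorClass col p.2) := by
  unfold sepSum
  refine sum_congr rfl fun v _ => ?_
  rw [sum_sepCount_colorClass, mul_sum]
  refine sum_congr rfl fun u _ => ?_
  rw [mul_sum]
  refine sum_congr rfl fun x _ => ?_
  rw [mul_sum]
  refine sum_congr rfl fun y _ => ?_
  rw [mul_left_comm]
  congr 1
  unfold mixedWeight
  congr 1
  simp only [indic, mixedPairs, mem_offDiag, mem_erase, mem_univ, and_true]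
  congr 1
  ext
  constructor
  · rintro ⟨h1, h2, h3, h4, h5, h6⟩
    exact ⟨h1, ⟨h5.symm, h2⟩, ⟨h6, h3⟩, h4.symm⟩
  · rintro ⟨h1, ⟨h5, h2⟩, ⟨h6, h3⟩, h4⟩
    exact ⟨h1, h2, h3, h4.symm, h5.symm, h6⟩

variable [DecidableEq V]

theorem IsOrderSign.three_mul_sepSum_all_same (h : IsOrderSign σ univ) (col : V → ι) :
    3 * sepSum σ col (fun a b c d => indic (a = b ∧ a = c ∧ a = d)) =
      ∑ i, ((colorClass col i).card : ℤ) * ((colorClass col i).card - 1) *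
        ((colorClass col i).card - 2) * ((colorClass col i).card - 3) := by
  simp only [← h.three_mul_sum_sep, ← mul_sum]
  congr 1
  unfold sepSum
  rw [← sum_fiberwise (s := univ) (g := col)]
  refine sum_congr rfl fun i _ => sum_congr rfl fun v hv => ?_
  have hv : col v = i := (mem_filter.mp hv).2
  have := sum_sepCount_colorClass (σ := σ) col v {(i, i)}
  rw [sum_singleton] at this
  simp only [sepCount] at this
  rw [this]
  refine sum_congr rfl fun u _ => sum_congr rfl fun x _ => sum_congr rfl fun y _ => ?_
  congr 1
  simp only [indic, mem_singleton, Prod.ext_iff]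
  congr 1
  ext
  rw [hv]
  constructor
  · rintro ⟨h1, h2, h3⟩
    exact ⟨h1, h3, h2.symm.trans h3⟩
  · rintro ⟨h1, h2, h3⟩
    exact ⟨h1, h2.trans h3.symm, h2⟩

/-- With the odd point `v` fixed, each other class contributes its order-independent count from
`three_mul_sepCount_self`. -/
theorem IsOrderSign.three_mul_sepSum_three_same (h : IsOrderSign σ univ) (col : V → ι) :
    3 * sepSum σ col (fun a b c d => indic (a = b ∧ a = c ∧ a ≠ d)) =
      ∑ i, ((Fintype.card V : ℤ) - (colorClass col i).card) * ((colorClass col i).card *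
        ((colorClass col i).card - 1) * ((colorClass col i).card - 2)) := by
  have e : sepSum σ col (fun a b c d => indic (a = b ∧ a = c ∧ a ≠ d)) =
      ∑ v, ∑ i ∈ univ.erase (col v),
        sepCount σ v (colorClass col i) (colorClass col i) := by
    refine sum_congr rfl fun v _ => ?_
    have := sum_sepCount_colorClass (σ := σ) col v (univ.erase (col v)).diag
    rw [sum_diag] at this
    rw [this]
    refine sum_congr rfl fun u _ => sum_congr rfl fun x _ => sum_congr rfl fun y _ => ?_
    congr 1
    simp only [indic, mem_diag, mem_erase, mem_univ, and_true]
    congr 1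
    ext
    tauto
  have e2 : ∀ v, ∑ i ∈ univ.erase (col v), 3 * sepCount σ v (colorClass col i) (colorClass col i) =
      ∑ i, if col v ≠ i then ((colorClass col i).card : ℤ) *
        ((colorClass col i).card - 1) * ((colorClass col i).card - 2) else 0 := by
    intro v
    rw [← filter_ne, sum_filter]
    refine sum_congr rfl fun i _ => ?_
    by_cases hv : col v = i
    · simp [hv]
    · simp only [hv, ne_eq, not_false_eq_true, if_true]
      exact h.three_mul_sepCount_self (by simp [colorClass, hv])
  rw [e, mul_sum]
  simp only [mul_sum, e2]
  rw [sum_comm]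
  refine sum_congr rfl fun i _ => ?_
  rw [← sum_filter, sum_const, nsmul_eq_mul]
  congr 1
  have := card_filter_add_card_filter_not (s := (univ : Finset V)) (fun v => col v = i)
  rw [card_univ] at this
  rw [← this]
  simp [colorClass]

/-- The sum of the terms of the count of non-crossing patterns that depend on the order. -/
def variablePart (σ : V → V → ℤ) (col : V → ι) (o : ι) : ℤ :=
  2 * mutualSepCount σ (colorClass col o) (univ.filter fun x => col x ≠ o) +
  ∑ p ∈ (univ.erase o).offDiag, mutualSepCount σ (colorClass col p.1) (colorClass col p.2) +
  2 * ∑ v, (if col v = o then 2 else 1) *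
      ∑ p ∈ mixedPairs o (col v), sepCount σ v (colorClass col p.1) (colorClass col p.2)

/-- The symmetries of `sep` identify the four three-alike patterns, the four mixed ones and the two
with a special pair; halving the doubled decomposition leaves the coefficients here and in
`variablePart`. -/
theorem IsOrderSign.properSepSum_eq (h : IsOrderSign σ univ) (col : V → ι) (o : ι) :
    sepSum σ col (fun _ _ _ _ => 1) = properSepSum σ col +
      sepSum σ col (fun a b c d => indic (a = b ∧ a = c ∧ a = d)) +
      4 * sepSum σ col (fun a b c d => indic (a = b ∧ a = c ∧ a ≠ d)) +
      variablePart σ col o := by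
  have key : sepSum σ col (fun _ _ _ _ => 2 * 1) = _ := congrArg (sepSum σ col)
    (funext fun a => funext fun b => funext fun c => funext fun d => color_decomposition o a b c d)
  have s1 := sepSum_comm_right (σ := σ) col (fun a b c d => indic (a = b ∧ a = c ∧ a ≠ d))
  have s2 := h.sepSum_swap col (fun a b c d => indic (a = b ∧ a = c ∧ a ≠ d))
  have s3 := sepSum_comm_left (σ := σ) col (fun a b c d => indic (c = d ∧ c = a ∧ c ≠ b))
  have s4 := h.sepSum_swap col (fun a b c d => indic (a = o ∧ b = o ∧ c ≠ o ∧ d ≠ o))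
  have s5 := sepSum_comm_right (σ := σ) col (mixedWeight o)
  have s6 := h.sepSum_swap col (mixedWeight o)
  have s7 := sepSum_comm_left (σ := σ) col (fun a b c d => mixedWeight o c d a b)
  have s8 := sepSum_eq_sum_mutualSepCount (σ := σ) col (univ.erase o).offDiag
  have s9 := sepSum_mixedWeight (σ := σ) col o
  have s10 := sepSum_eq_mutualSepCount (σ := σ) col o
  simp only [mem_offDiag, mem_erase, mem_univ, and_true] at s8
  simp only [sepSum_add, sepSum_mul_left] at key
  unfold variablePart properSepSum
  rw [← s8, ← s9, ← s10]
  rw [s1, s3, s2, s4, s5, s7, s6] at key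
  linarith

end ColoredBound

/-! ### The lower bound for the complete multipartite graph -/

section MultipartiteBound

open Finset

theorem sum_offDiag_swap {ι : Type*} [DecidableEq ι] (s : Finset ι) (f : ι → ι → ℤ) :
    2 * ∑ q ∈ s.offDiag, f q.1 q.2 = ∑ q ∈ s.offDiag, (f q.1 q.2 + f q.2 q.1) := by
  have : ∑ q ∈ s.offDiag, f q.2 q.1 = ∑ q ∈ s.offDiag, f q.1 q.2 :=
    sum_nbij' Prod.swap Prod.swap (by simp +contextual [eq_comm]) (by simp +contextual [eq_comm])
      (by simp) (by simp) (by simp)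
  rw [sum_add_distrib, this, two_mul]

variable {V ι : Type*} [Fintype V] [DecidableEq ι] {σ : V → V → ℤ}
  {col : V → ι} {o : ι} {m n p : ℕ}

theorem mem_colorClass {i : ι} {x : V} : x ∈ colorClass col i ↔ col x = i := by
  simp [colorClass]

theorem disjoint_colorClass {i j : ι} (hij : i ≠ j) :
    Disjoint (colorClass col i) (colorClass col j) := by
  rw [disjoint_left]
  intro x hx hx'
  exact hij ((mem_colorClass.mp hx).symm.trans (mem_colorClass.mp hx'))

variable [Fintype ι]

/-- `col` is the colouring of `K(p^(1), m^(n))` by partite sets, `o` being the set of size `p`. -/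
structure IsPartiteColoring (col : V → ι) (o : ι) (m n p : ℕ) : Prop where
  card_index : Fintype.card ι = n + 1
  card_special : (colorClass col o).card = p
  card_class : ∀ i ≠ o, (colorClass col i).card = m

theorem IsPartiteColoring.card_erase (h : IsPartiteColoring col o m n p) :
    (univ.erase o).card = n := by
  rw [card_erase_of_mem (mem_univ _), card_univ, h.card_index]
  rfl

theorem IsPartiteColoring.sum_card (h : IsPartiteColoring col o m n p) (f : ℕ → ℤ) :
    ∑ i, f (colorClass col i).card = f p + n * f m := by
  rw [← add_sum_erase univ _ (mem_univ o), h.card_special,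
    sum_congr rfl (g := fun _ => f m) fun i hi => by rw [h.card_class i (ne_of_mem_erase hi)],
    sum_const, h.card_erase, nsmul_eq_mul]

theorem IsPartiteColoring.card_compl (h : IsPartiteColoring col o m n p) :
    (univ.filter fun x => col x ≠ o).card = m * n := by
  rw [card_eq_sum_card_fiberwise (f := col) (t := univ.erase o)]
  · rw [sum_congr rfl (g := fun _ => m), sum_const, h.card_erase, smul_eq_mul, mul_comm]
    intro i hi
    rw [← h.card_class i (ne_of_mem_erase hi), filter_filter]
    congr 1
    ext x
    simp only [mem_filter, mem_univ, true_and, mem_colorClass]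
    exact ⟨fun e => e.2, fun e => ⟨e ▸ ne_of_mem_erase hi, e⟩⟩
  · intro x hx
    simpa using hx

theorem IsPartiteColoring.card_eq (h : IsPartiteColoring col o m n p) :
    Fintype.card V = p + m * n := by
  rw [← card_univ, ← card_filter_add_card_filter_not (fun x => col x = o)]
  exact congrArg₂ _ h.card_special h.card_compl

/-- The largest value of `3 * variablePart`. -/
def variablePartBound (m n p : ℤ) : ℤ :=
  2 * (m * n) ^ 2 * (p ^ 2 - 1) + n * (n - 1) * (m ^ 2 * (m ^ 2 - 1)) +
    4 * (p * (n * (n - 1)) * (m ^ 3 - m)) + 2 * (m * n * ((n - 1) * (n - 2)) * (m ^ 3 - m))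

theorem IsPartiteColoring.card_offDiag (h : IsPartiteColoring col o m n p) :
    ((univ.erase o).offDiag.card : ℤ) = n * (n - 1) := by
  rw [offDiag_card, h.card_erase, Nat.cast_sub (Nat.le_mul_self n)]
  push_cast
  ring

theorem IsPartiteColoring.card_mixedPairs (h : IsPartiteColoring col o m n p) (d : ι) :
    ((mixedPairs o d).card : ℤ) = if d = o then (n : ℤ) * (n - 1) else (n - 1) * (n - 2) := by
  unfold mixedPairs
  split_ifs with e
  · rw [e, erase_eq_of_notMem (notMem_erase _ _), h.card_offDiag]
  · have hd : d ∈ univ.erase o := mem_erase.mpr ⟨e, mem_univ _⟩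
    rw [offDiag_card, Nat.cast_sub (Nat.le_mul_self _), Nat.cast_mul, cast_card_erase_of_mem hd,
      h.card_erase]
    ring

theorem IsPartiteColoring.sum_weight (h : IsPartiteColoring col o m n p) (k : ℤ) :
    ∑ v, (if col v = o then 2 else 1) * (((mixedPairs o (col v)).card : ℤ) * k) =
      2 * (p * (n * (n - 1)) * k) + m * n * ((n - 1) * (n - 2)) * k := by
  rw [← sum_filter_add_sum_filter_not univ (fun v => col v = o)]
  rw [sum_congr rfl (g := fun _ => 2 * (((n : ℤ) * (n - 1)) * k)),
    sum_congr (s₁ := univ.filter fun v => ¬ col v = o) rfl (g := fun _ => (((n : ℤ) - 1) * (n - 2)) * k)]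
  · rw [sum_const, sum_const, nsmul_eq_mul, nsmul_eq_mul]
    have h1 := h.card_special
    have h2 := h.card_compl
    unfold colorClass at h1
    simp only [ne_eq] at h2
    rw [h1, h2]
    push_cast
    ring
  · intro v hv
    have hv : col v ≠ o := (mem_filter.mp hv).2
    rw [if_neg hv, h.card_mixedPairs, if_neg hv]
    ring
  · intro v hv
    have hv : col v = o := (mem_filter.mp hv).2
    rw [if_pos hv, h.card_mixedPairs, if_pos hv]

/-- Symmetrizes the mixed term in its two classes, since only the sum of the two `sepCount`s has a
sharp bound. -/
theorem three_mul_variablePart (σ : V → V → ℤ) (col : V → ι) (o : ι) :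
    3 * variablePart σ col o =
      2 * (3 * mutualSepCount σ (colorClass col o) (univ.filter fun x => col x ≠ o)) +
      ∑ q ∈ (univ.erase o).offDiag,
        3 * mutualSepCount σ (colorClass col q.1) (colorClass col q.2) +
      ∑ v, (if col v = o then 2 else 1) * ∑ q ∈ mixedPairs o (col v),
        3 * (sepCount σ v (colorClass col q.1) (colorClass col q.2) +
          sepCount σ v (colorClass col q.2) (colorClass col q.1)) := by
  have hW : ∀ v, ∑ q ∈ mixedPairs o (col v),
      3 * (sepCount σ v (colorClass col q.1) (colorClass col q.2) +
        sepCount σ v (colorClass col q.2) (colorClass col q.1)) =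
      6 * ∑ q ∈ mixedPairs o (col v), sepCount σ v (colorClass col q.1) (colorClass col q.2) := by
    intro v
    rw [← mul_sum, mixedPairs,
      ← sum_offDiag_swap _ fun i j => sepCount σ v (colorClass col i) (colorClass col j)]
    ring
  simp only [hW, mul_left_comm _ (6 : ℤ), ← mul_sum]
  unfold variablePart
  ring

theorem IsPartiteColoring.three_mul_variablePart_eq (h : IsPartiteColoring col o m n p)
    (hX : 3 * mutualSepCount σ (colorClass col o) (univ.filter fun x => col x ≠ o) =
      ((m : ℤ) * n) ^ 2 * ((p : ℤ) ^ 2 - 1))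
    (hS : ∀ i ≠ o, ∀ j ≠ o, i ≠ j → 3 * mutualSepCount σ (colorClass col i) (colorClass col j) =
      (m : ℤ) ^ 2 * ((m : ℤ) ^ 2 - 1))
    (hG : ∀ v, ∀ i ≠ o, ∀ j ≠ o, i ≠ j → col v ≠ i → col v ≠ j →
      3 * (sepCount σ v (colorClass col i) (colorClass col j) +
        sepCount σ v (colorClass col j) (colorClass col i)) = 2 * ((m : ℤ) ^ 3 - m)) :
    3 * variablePart σ col o = variablePartBound m n p := by
  rw [three_mul_variablePart, hX, sum_congr rfl (g := fun _ => (m : ℤ) ^ 2 * ((m : ℤ) ^ 2 - 1)),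
    sum_const, nsmul_eq_mul, h.card_offDiag, sum_congr (s₁ := univ) rfl (g := fun v =>
      (if col v = o then 2 else 1) * (((mixedPairs o (col v)).card : ℤ) * (2 * ((m : ℤ) ^ 3 - m)))),
    h.sum_weight]
  · unfold variablePartBound
    ring
  · intro v _
    rw [sum_congr rfl (g := fun _ => 2 * ((m : ℤ) ^ 3 - m)), sum_const, nsmul_eq_mul]
    intro q hq
    simp only [mixedPairs, mem_offDiag, mem_erase, mem_univ, and_true] at hq
    exact hG v _ hq.1.2 _ hq.2.1.2 hq.2.2 hq.1.1.symm hq.2.1.1.symm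
  · intro q hq
    simp only [mem_offDiag, mem_erase, mem_univ, and_true] at hq
    exact hS _ hq.1 _ hq.2.1 hq.2.2

variable [DecidableEq V]

theorem IsPartiteColoring.three_mul_variablePart_le (h : IsPartiteColoring col o m n p)
    (hσ : IsOrderSign σ univ) (hdvd : p ∣ m * n) :
    3 * variablePart σ col o ≤ variablePartBound m n p := by
  have hX : 3 * mutualSepCount σ (colorClass col o) (univ.filter fun x => col x ≠ o) ≤
      ((m : ℤ) * n) ^ 2 * ((p : ℤ) ^ 2 - 1) := by
    obtain ⟨q, hq⟩ := hdvd
    have := hσ.mutualSepCount_le (A := colorClass col o) (D := univ.filter fun x => col x ≠ o)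
      (q := q) (disjoint_filter_filter_not _ _ _)
      (by rw [h.card_compl, h.card_special, hq]; push_cast; ring)
    rwa [h.card_compl, h.card_special, Nat.cast_mul] at this
  have hS : ∑ q ∈ (univ.erase o).offDiag,
        3 * mutualSepCount σ (colorClass col q.1) (colorClass col q.2) ≤
      ∑ q ∈ (univ.erase o).offDiag, (m : ℤ) ^ 2 * ((m : ℤ) ^ 2 - 1) := by
    refine sum_le_sum fun q hq => ?_
    simp only [mem_offDiag, mem_erase, mem_univ, and_true] at hq
    have := hσ.mutualSepCount_le (q := 1) (disjoint_colorClass (col := col) hq.2.2)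
      (by rw [h.card_class _ hq.1, h.card_class _ hq.2.1, one_mul])
    rwa [h.card_class _ hq.1, h.card_class _ hq.2.1] at this
  have hG : ∑ v, (if col v = o then 2 else 1) * ∑ q ∈ mixedPairs o (col v),
        3 * (sepCount σ v (colorClass col q.1) (colorClass col q.2) +
          sepCount σ v (colorClass col q.2) (colorClass col q.1)) ≤
      ∑ v, (if col v = o then 2 else 1) *
        (((mixedPairs o (col v)).card : ℤ) * (2 * ((m : ℤ) ^ 3 - m))) := by
    refine sum_le_sum fun v _ => mul_le_mul_of_nonneg_left ?_ (by split_ifs <;> norm_num)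
    rw [← nsmul_eq_mul, ← sum_const]
    refine sum_le_sum fun q hq => ?_
    simp only [mixedPairs, mem_offDiag, mem_erase, mem_univ, and_true] at hq
    have := hσ.sepCount_add_sepCount_le (v := v) (A := colorClass col q.1)
      (B := colorClass col q.2) (fun e => hq.1.1 (mem_colorClass.mp e).symm)
      (fun e => hq.2.1.1 (mem_colorClass.mp e).symm) (disjoint_colorClass hq.2.2)
      (by rw [h.card_class _ hq.1.2, h.card_class _ hq.2.1.2])
    rwa [h.card_class _ hq.1.2] at this
  rw [sum_const, nsmul_eq_mul, h.card_offDiag] at hS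
  rw [h.sum_weight] at hG
  rw [three_mul_variablePart]
  unfold variablePartBound
  linarith

/-- Twenty-four times the crossing number of `K(p^(1), m^(n))`. -/
def crossingValue (m n p : ℤ) : ℤ :=
  m ^ 4 * n ^ 4 + 2 * m ^ 2 * n ^ 3 - 2 * m ^ 4 * n ^ 3 - 6 * m ^ 3 * n ^ 3 + 12 * m ^ 3 * n ^ 2
    + m ^ 4 * n ^ 2 - 6 * m ^ 3 * n + 4 * m ^ 2 * n ^ 2 * p ^ 2 - 6 * p ^ 2 * m * n
    - 18 * m ^ 2 * n ^ 2 * p + 2 * m * n * p + 12 * m ^ 2 * n * p - 4 * m ^ 3 * n ^ 2 * p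
    + 4 * m ^ 3 * n ^ 3 * p + 4 * m * n ^ 2 * p

/-- The order-independent counts are inserted here; `crossingValue` is what remains when
`variablePart` takes its largest value. -/
theorem IsPartiteColoring.three_mul_properSepSum (h : IsPartiteColoring col o m n p)
    (hσ : IsOrderSign σ univ) :
    3 * properSepSum σ col + 3 * variablePart σ col o =
      crossingValue m n p + variablePartBound m n p := by
  have h1 := hσ.properSepSum_eq col o
  have h2 := hσ.three_mul_sepSum_all_same col
  have h3 := hσ.three_mul_sepSum_three_same col
  have h4 := hσ.three_mul_sum_sep univ
  have h5 : sepSum σ col (fun _ _ _ _ => 1) = ∑ v, ∑ u, ∑ x, ∑ y, sep σ x y u v := by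
    simp only [sepSum, mul_one]
  rw [← h5] at h4
  rw [h.sum_card fun k => (k : ℤ) * (k - 1) * (k - 2) * (k - 3)] at h2
  rw [h.sum_card fun k => ((Fintype.card V : ℤ) - k) * (k * (k - 1) * (k - 2)), h.card_eq] at h3
  rw [card_univ, h.card_eq] at h4
  push_cast at h3 h4
  unfold crossingValue variablePartBound
  linear_combination h4 - 3 * h1 - h2 - 4 * h3

theorem IsPartiteColoring.crossingValue_le (h : IsPartiteColoring col o m n p)
    (hσ : IsOrderSign σ univ) (hdvd : p ∣ m * n) :
    crossingValue m n p ≤ 3 * properSepSum σ col := by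
  have := h.three_mul_properSepSum hσ
  have := h.three_mul_variablePart_le hσ hdvd
  linarith

end MultipartiteBound

/-! ### The word that attains all bounds -/

section OptimalWord

open Finset

/-- The vertices of `multipartiteK p 1 m n`. -/
abbrev PartiteVertex (m n p : ℕ) : Type :=
  Σ i : Fin 1 ⊕ Fin n, Fin (Sum.elim (fun _ => p) (fun _ => m) i)

variable {m n p : ℕ}

/-- A vertex of the partite set of size `p`. -/
abbrev specialVertex (m n : ℕ) {p : ℕ} (s : Fin p) : PartiteVertex m n p := ⟨Sum.inl 0, s⟩

/-- A vertex of the `i`th partite set of size `m`. -/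
abbrev classVertex {m n : ℕ} (p : ℕ) (i : Fin n) (r : Fin m) : PartiteVertex m n p := ⟨Sum.inr i, r⟩

/-- The partite set of a vertex. -/
abbrev partiteSet (x : PartiteVertex m n p) : Fin 1 ⊕ Fin n := x.1

theorem card_filter_sigma_fst {ι : Type*} {α : ι → Type*} [Fintype ι] [DecidableEq ι]
    [∀ i, Fintype (α i)] (i : ι) :
    (univ.filter fun x : Σ i, α i => x.1 = i).card = Fintype.card (α i) := by
  have : (univ.filter fun x : Σ i, α i => x.1 = i) = univ.map (Function.Embedding.sigmaMk i) := by
    ext ⟨j, x⟩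
    simp only [mem_filter, mem_univ, true_and, mem_map, Function.Embedding.sigmaMk_apply]
    constructor
    · rintro rfl
      exact ⟨x, rfl⟩
    · rintro ⟨y, hy⟩
      exact (congrArg Sigma.fst hy).symm
  rw [this, card_map, card_univ]

theorem isPartiteColoring_partiteSet (m n p : ℕ) :
    IsPartiteColoring (partiteSet (m := m) (n := n) (p := p)) (Sum.inl 0) m n p where
  card_index := by simp [add_comm]
  card_special := by
    unfold colorClass
    rw [card_filter_sigma_fst]
    exact Fintype.card_fin _
  card_class i hi := by
    unfold colorClass
    rw [card_filter_sigma_fst]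
    rcases i with i | i
    · exact absurd (congrArg Sum.inl (Subsingleton.elim i 0)) hi
    · exact Fintype.card_fin _

theorem exists_eq_specialVertex {x : PartiteVertex m n p}
    (hx : x ∈ colorClass partiteSet (Sum.inl 0)) : ∃ s, x = specialVertex m n s := by
  obtain ⟨i, s⟩ := x
  obtain rfl : i = Sum.inl 0 := mem_colorClass.mp hx
  exact ⟨s, rfl⟩

theorem exists_eq_classVertex {x : PartiteVertex m n p} {i : Fin n}
    (hx : x ∈ colorClass partiteSet (Sum.inr i)) : ∃ r, x = classVertex p i r := by
  obtain ⟨j, s⟩ := x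
  obtain rfl : j = Sum.inr i := mem_colorClass.mp hx
  exact ⟨s, rfl⟩

theorem exists_eq_classVertex_of_ne {x : PartiteVertex m n p}
    (hx : partiteSet x ≠ Sum.inl 0) : ∃ i r, x = classVertex p i r := by
  obtain ⟨j | j, s⟩ := x
  · exact absurd (congrArg Sum.inl (Subsingleton.elim j 0)) hx
  · exact ⟨j, s, rfl⟩

/-- The positions of the vertices in an optimal drawing: the partite sets of size `m` take turns,
and the `p` special vertices are inserted at distance `q`. -/
def wordKey (q : ℕ) : PartiteVertex m n p → ℕ
  | ⟨Sum.inl _, s⟩ => 2 * (q * s.val)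
  | ⟨Sum.inr i, r⟩ => 2 * (r.val * n + i.val) + 1

@[simp] theorem wordKey_classVertex (q : ℕ) (i : Fin n) (r : Fin m) :
    wordKey q (classVertex p i r) = 2 * (r.val * n + i.val) + 1 := rfl

theorem wordKey_classVertex_lt (q : ℕ) {r s : Fin m} (hrs : r < s) (i j : Fin n) :
    wordKey q (classVertex p i r) < wordKey q (classVertex p j s) := by
  have : (r.val + 1) * n ≤ s.val * n := Nat.mul_le_mul_right n hrs
  have := i.isLt
  simp only [wordKey_classVertex]
  rw [add_mul] at *
  omega

theorem wordKey_classVertex_le (q : ℕ) {r s : Fin m} (hrs : r ≤ s) (i : Fin n) :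
    wordKey q (classVertex p i r) ≤ wordKey q (classVertex p i s) := by
  rcases hrs.lt_or_eq with h | rfl
  · exact (wordKey_classVertex_lt q h i i).le
  · exact le_rfl

theorem wordKey_classVertex_lt_of_lt (q : ℕ) {i j : Fin n} (hij : i < j) {r s : Fin m}
    (hrs : r ≤ s) : wordKey q (classVertex p i r) < wordKey q (classVertex p j s) := by
  rcases hrs.lt_or_eq with h | rfl
  · exact wordKey_classVertex_lt q h i j
  · simp only [wordKey_classVertex]
    have : i.val < j.val := hij
    omega

/-- Special vertices have even keys and class vertices odd ones; `0 < q` keeps the special vertices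
apart. -/
theorem wordKey_injective {q : ℕ} (hq : 0 < q) :
    Function.Injective (wordKey q : PartiteVertex m n p → ℕ) := by
  have key : ∀ (i j : Fin n) (r s : Fin m),
      wordKey q (classVertex p i r) = wordKey q (classVertex p j s) →
      classVertex p i r = classVertex p j s := by
    intro i j r s h
    rcases lt_trichotomy r s with hrs | rfl | hrs
    · exact absurd h (wordKey_classVertex_lt q hrs i j).ne
    · simp only [wordKey_classVertex] at h
      have : i = j := Fin.ext (by omega)
      rw [this]
    · exact absurd h (wordKey_classVertex_lt q hrs j i).ne'
  rintro ⟨i | i, r⟩ ⟨j | j, s⟩ h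
  · obtain rfl : i = j := Subsingleton.elim _ _
    have h : 2 * (q * r.val) = 2 * (q * s.val) := h
    have : r.val = s.val := Nat.eq_of_mul_eq_mul_left hq (by omega)
    rw [Fin.ext this]
  · have h : 2 * (q * r.val) = 2 * (s.val * n + j.val) + 1 := h
    omega
  · have h : 2 * (r.val * n + i.val) + 1 = 2 * (q * s.val) := h
    omega
  · exact key i j r s h

/-- Move a class vertex to the partite set `i`. -/
def recolor (i : Fin n) : PartiteVertex m n p → PartiteVertex m n p
  | ⟨Sum.inl a, s⟩ => ⟨Sum.inl a, s⟩
  | ⟨Sum.inr _, r⟩ => ⟨Sum.inr i, r⟩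

@[simp] theorem recolor_classVertex (i j : Fin n) (r : Fin m) :
    recolor i (classVertex p j r) = classVertex p i r := rfl

/-- The cyclic successor in `Fin m`. -/
def cyclicSucc {m : ℕ} (r : Fin m) : Fin m :=
  if h : r.val + 1 < m then ⟨r.val + 1, h⟩ else ⟨0, r.pos⟩

theorem cyclicSucc_injective : Function.Injective (cyclicSucc : Fin m → Fin m) := by
  intro r s h
  have hr := r.isLt
  have hs := s.isLt
  unfold cyclicSucc at h
  split_ifs at h <;> simp only [Fin.mk.injEq] at h <;> apply Fin.ext <;> omega

/-- Move a class vertex to the next vertex of the partite set `i`. -/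
def recolorSucc (i : Fin n) : PartiteVertex m n p → PartiteVertex m n p
  | ⟨Sum.inl a, s⟩ => ⟨Sum.inl a, s⟩
  | ⟨Sum.inr _, r⟩ => ⟨Sum.inr i, cyclicSucc r⟩

@[simp] theorem recolorSucc_classVertex (i j : Fin n) (r : Fin m) :
    recolorSucc i (classVertex p j r) = classVertex p i (cyclicSucc r) := rfl

theorem classVertex_injective (i : Fin n) :
    Function.Injective (classVertex p i : Fin m → PartiteVertex m n p) :=
  fun _ _ e => eq_of_heq (Sigma.mk.inj_iff.mp e).2

theorem card_colorClass_inr (i : Fin n) :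
    (colorClass (partiteSet (m := m) (n := n) (p := p)) (Sum.inr i)).card = m :=
  (isPartiteColoring_partiteSet m n p).card_class _ (by simp)

theorem classVertex_mem (i : Fin n) (r : Fin m) :
    classVertex p i r ∈ colorClass (partiteSet (m := m) (n := n) (p := p)) (Sum.inr i) :=
  mem_colorClass.mpr rfl

theorem bijOn_colorClass {i j : Fin n} (β : PartiteVertex m n p → PartiteVertex m n p)
    (g : Fin m → Fin m) (hg : g.Injective)
    (hβ : ∀ r, β (classVertex p j r) = classVertex p i (g r)) :
    Set.BijOn β (colorClass (partiteSet (m := m) (n := n) (p := p)) (Sum.inr j))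
      (colorClass (partiteSet (m := m) (n := n) (p := p)) (Sum.inr i)) := by
  have hmaps : Set.MapsTo β (colorClass (partiteSet (m := m) (n := n) (p := p)) (Sum.inr j))
      (colorClass (partiteSet (m := m) (n := n) (p := p)) (Sum.inr i)) := by
    intro x hx
    obtain ⟨r, rfl⟩ := exists_eq_classVertex hx
    rw [hβ]
    exact classVertex_mem _ _
  have hinj : Set.InjOn β (colorClass (partiteSet (m := m) (n := n) (p := p)) (Sum.inr j)) := by
    intro x hx y hy hxy
    obtain ⟨r, rfl⟩ := exists_eq_classVertex hx
    obtain ⟨s, rfl⟩ := exists_eq_classVertex hy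
    rw [hβ, hβ] at hxy
    rw [hg (classVertex_injective i hxy)]
  refine ⟨hmaps, hinj, surjOn_of_injOn_of_card_le β hmaps hinj ?_⟩
  rw [card_colorClass_inr, card_colorClass_inr]

theorem keySign_eq_of_lt_iff {V R : Type*} [LinearOrder R] {κ : V → R} {a b c d : V}
    (h : (κ a < κ b ∧ κ c < κ d) ∨ (κ b < κ a ∧ κ d < κ c)) : keySign κ a b = keySign κ c d := by
  rcases h with ⟨h1, h2⟩ | ⟨h1, h2⟩
  · rw [keySign_of_lt h1, keySign_of_lt h2]
  · rw [keySign_of_gt h1, keySign_of_gt h2]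

/-- The two classes alternate, so each vertex of class `j` is grouped with that of class `i` in the
same round: blocks of size 1. -/
theorem mutualSepCount_wordKey_class {q : ℕ} (hq : 0 < q) {i j : Fin n} (hij : i ≠ j) :
    3 * mutualSepCount (keySign (wordKey (p := p) q))
      (colorClass (partiteSet (m := m) (n := n) (p := p)) (Sum.inr i))
      (colorClass (partiteSet (m := m) (n := n) (p := p)) (Sum.inr j)) =
      (m : ℤ) ^ 2 * ((m : ℤ) ^ 2 - 1) := by
  have hσ := isOrderSign_keySign (wordKey_injective (m := m) (n := n) (p := p) hq) univ
  have hβ := bijOn_colorClass (p := p) (m := m) (i := i) (j := j) (recolor i) id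
    Function.injective_id fun r => rfl
  have := hσ.mutualSepCount_eq (q := 1) (ε := if i < j then -1 else 1)
    (disjoint_colorClass (col := partiteSet (m := m) (n := n) (p := p)) (i := Sum.inr i)
      (j := Sum.inr j) (by simpa using hij)) (recolor i) (fun u hu => hβ.mapsTo hu) ?_ ?_ ?_
  · rwa [card_colorClass_inr, card_colorClass_inr] at this
  · intro a ha
    obtain ⟨u, hu, rfl⟩ := hβ.surjOn ha
    rw [card_eq_one]
    refine ⟨u, ?_⟩
    ext w
    simp only [mem_filter, mem_singleton]
    constructor
    · rintro ⟨hw, e⟩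
      exact hβ.injOn hw hu e
    · rintro rfl
      exact ⟨hu, rfl⟩
  · intro u hu
    obtain ⟨r, rfl⟩ := exists_eq_classVertex hu
    rw [recolor_classVertex]
    split_ifs with h
    · exact keySign_of_lt (wordKey_classVertex_lt_of_lt q h le_rfl)
    · exact keySign_of_gt (wordKey_classVertex_lt_of_lt q
        (lt_of_le_of_ne (not_lt.mp h) hij.symm) le_rfl)
  · intro x hx u hu hne
    obtain ⟨r, rfl⟩ := exists_eq_classVertex hu
    obtain ⟨s, rfl⟩ := exists_eq_classVertex hx
    rw [recolor_classVertex] at hne ⊢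
    refine keySign_eq_of_lt_iff ?_
    rcases lt_trichotomy r s with h | rfl | h
    · exact Or.inr ⟨wordKey_classVertex_lt q h _ _, wordKey_classVertex_lt q h _ _⟩
    · exact absurd rfl hne
    · exact Or.inl ⟨wordKey_classVertex_lt q h _ _, wordKey_classVertex_lt q h _ _⟩

/-- Cut at `v`, the alternating classes still alternate; the matching depends on which of the two
comes first after the cut. -/
theorem sepCount_wordKey_of_lt {q : ℕ} (hq : 0 < q) {i j : Fin n} (hij : i < j)
    (v : PartiteVertex m n p) (hvi : partiteSet v ≠ Sum.inr i) (hvj : partiteSet v ≠ Sum.inr j) :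
    3 * (sepCount (keySign (wordKey q)) v
        (colorClass (partiteSet (m := m) (n := n) (p := p)) (Sum.inr i))
        (colorClass (partiteSet (m := m) (n := n) (p := p)) (Sum.inr j)) +
      sepCount (keySign (wordKey q)) v
        (colorClass (partiteSet (m := m) (n := n) (p := p)) (Sum.inr j))
        (colorClass (partiteSet (m := m) (n := n) (p := p)) (Sum.inr i))) =
      2 * ((m : ℤ) ^ 3 - m) := by
  have hinj := wordKey_injective (m := m) (n := n) (p := p) hq
  have hσ := isOrderSign_keySign hinj univ
  have hA : v ∉ colorClass (partiteSet (m := m) (n := n) (p := p)) (Sum.inr i) :=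
    fun e => hvi (mem_colorClass.mp e)
  have hB : v ∉ colorClass (partiteSet (m := m) (n := n) (p := p)) (Sum.inr j) :=
    fun e => hvj (mem_colorClass.mp e)
  have hAB := disjoint_colorClass (col := partiteSet (m := m) (n := n) (p := p)) (i := Sum.inr i)
      (j := Sum.inr j) (by simpa using hij.ne)
  have hcard : (colorClass (partiteSet (m := m) (n := n) (p := p)) (Sum.inr i)).card =
      (colorClass (partiteSet (m := m) (n := n) (p := p)) (Sum.inr j)).card := by
    rw [card_colorClass_inr, card_colorClass_inr]
  have hm : ((colorClass (partiteSet (m := m) (n := n) (p := p)) (Sum.inr i)).card : ℤ) = m := by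
    rw [card_colorClass_inr]
  rw [← hm]
  -- If `v` splits the pair of some round, each vertex of class `j` is matched with the cyclically
  -- next one of class `i`; otherwise with its partner in the same round.
  by_cases hv : ∃ r : Fin m, wordKey q (classVertex p i r) < wordKey q v ∧
      wordKey q v < wordKey q (classVertex p j r)
  · obtain ⟨t, ht1, ht2⟩ := hv
    refine hσ.sepCount_add_sepCount_eq hA hB hAB hcard (recolorSucc i)
      (bijOn_colorClass _ cyclicSucc cyclicSucc_injective fun r => rfl) ?_
    intro x hx b hb hne
    obtain ⟨s, rfl⟩ := exists_eq_classVertex hx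
    obtain ⟨r, rfl⟩ := exists_eq_classVertex hb
    rw [recolorSucc_classVertex] at hne ⊢
    have hne : cyclicSucc r ≠ s := fun e => hne (by rw [e])
    unfold cutSign
    unfold cyclicSucc at hne ⊢
    split_ifs at hne ⊢ with hr
    · have hsucc : r < ⟨r.val + 1, hr⟩ := Fin.mk_lt_mk.mpr (Nat.lt_succ_self _)
      have e1 : keySign (wordKey q) (classVertex p i s) (classVertex p j r) =
          keySign (wordKey q) (classVertex p i s) (classVertex p i ⟨r.val + 1, hr⟩) := by
        refine keySign_eq_of_lt_iff ?_
        rcases le_or_gt s r with h | h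
        · exact Or.inl ⟨wordKey_classVertex_lt_of_lt q hij h,
            wordKey_classVertex_lt q (h.trans_lt hsucc) _ _⟩
        · have : (⟨r.val + 1, hr⟩ : Fin m) < s := lt_of_le_of_ne (Fin.mk_le_of_le_val h) hne
          exact Or.inr ⟨wordKey_classVertex_lt q h _ _, wordKey_classVertex_lt q this _ _⟩
      have e2 : keySign (wordKey q) (classVertex p j r) v =
          keySign (wordKey q) (classVertex p i ⟨r.val + 1, hr⟩) v := by
        refine keySign_eq_of_lt_iff ?_
        rcases lt_or_ge r t with h | h
        · have h' : (⟨r.val + 1, hr⟩ : Fin m) ≤ t := Fin.mk_le_of_le_val h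
          exact Or.inl ⟨(wordKey_classVertex_lt q h _ _).trans ht1,
            (wordKey_classVertex_le q h' _).trans_lt ht1⟩
        · exact Or.inr ⟨ht2.trans_le (wordKey_classVertex_le q h _),
            ht2.trans (wordKey_classVertex_lt q (h.trans_lt hsucc) _ _)⟩
      rw [e1, e2]
    -- The last vertex of class `j` is matched with the first of class `i`. They lie on different
    -- sides of `v` in the linear order, so both sign factors flip and the product is unchanged.
    · have hs := s.isLt
      have hr' := r.isLt
      have h0 : (⟨0, r.pos⟩ : Fin m) < s := by
        refine lt_of_le_of_ne (Fin.mk_le_of_le_val (Nat.zero_le _)) hne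
      have hsr : s ≤ r := Fin.le_def.mpr (by omega)
      have htr : t ≤ r := Fin.le_def.mpr (by have := t.isLt; omega)
      have h0t : (⟨0, r.pos⟩ : Fin m) ≤ t := Fin.mk_le_of_le_val (Nat.zero_le _)
      rw [keySign_of_lt (wordKey_classVertex_lt_of_lt q hij hsr),
        keySign_of_gt (wordKey_classVertex_lt q h0 i i),
        keySign_of_gt (ht2.trans_le (wordKey_classVertex_le q htr j)),
        keySign_of_lt ((wordKey_classVertex_le q h0t i).trans_lt ht1)]
      ring
  · push Not at hv
    refine hσ.sepCount_add_sepCount_eq hA hB hAB hcard (recolor i)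
      (bijOn_colorClass _ id Function.injective_id fun r => rfl) ?_
    intro x hx b hb hne
    obtain ⟨s, rfl⟩ := exists_eq_classVertex hx
    obtain ⟨r, rfl⟩ := exists_eq_classVertex hb
    rw [recolor_classVertex] at hne ⊢
    have e1 : keySign (wordKey q) (classVertex p i s) (classVertex p j r) =
        keySign (wordKey q) (classVertex p i s) (classVertex p i r) := by
      refine keySign_eq_of_lt_iff ?_
      rcases lt_trichotomy r s with h | rfl | h
      · exact Or.inr ⟨wordKey_classVertex_lt q h _ _, wordKey_classVertex_lt q h _ _⟩
      · exact absurd rfl hne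
      · exact Or.inl ⟨wordKey_classVertex_lt q h _ _, wordKey_classVertex_lt q h _ _⟩
    have e2 : keySign (wordKey q) (classVertex p j r) v =
        keySign (wordKey q) (classVertex p i r) v := by
      refine keySign_eq_of_lt_iff ?_
      have hlt := wordKey_classVertex_lt_of_lt (p := p) q hij (le_refl r)
      have hne' : wordKey q (classVertex p i r) ≠ wordKey q v := fun e =>
        hvi (congrArg partiteSet (hinj e)).symm
      have hne'' : wordKey q (classVertex p j r) ≠ wordKey q v := fun e =>
        hvj (congrArg partiteSet (hinj e)).symm
      have := hv r
      omega
    unfold cutSign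
    rw [e1, e2]

theorem sepCount_wordKey {q : ℕ} (hq : 0 < q) {i j : Fin n} (hij : i ≠ j)
    (v : PartiteVertex m n p) (hvi : partiteSet v ≠ Sum.inr i) (hvj : partiteSet v ≠ Sum.inr j) :
    3 * (sepCount (keySign (wordKey q)) v
        (colorClass (partiteSet (m := m) (n := n) (p := p)) (Sum.inr i))
        (colorClass (partiteSet (m := m) (n := n) (p := p)) (Sum.inr j)) +
      sepCount (keySign (wordKey q)) v
        (colorClass (partiteSet (m := m) (n := n) (p := p)) (Sum.inr j))
        (colorClass (partiteSet (m := m) (n := n) (p := p)) (Sum.inr i))) =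
      2 * ((m : ℤ) ^ 3 - m) := by
  rcases lt_or_gt_of_ne hij with h | h
  · exact sepCount_wordKey_of_lt hq h v hvi hvj
  · rw [add_comm]
    exact sepCount_wordKey_of_lt hq h v hvj hvi

theorem classIndex_lt (i : Fin n) (r : Fin m) : r.val * n + i.val < m * n := by
  have h1 : (r.val + 1) * n ≤ m * n := Nat.mul_le_mul_right n r.isLt
  have h2 := i.isLt
  rw [add_mul] at h1
  omega

/-- The special vertex whose block contains a given class vertex. -/
def blockVertex {q : ℕ} (h : m * n = p * q) : PartiteVertex m n p → PartiteVertex m n p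
  | ⟨Sum.inl a, s⟩ => ⟨Sum.inl a, s⟩
  | ⟨Sum.inr i, r⟩ => specialVertex m n ⟨(r.val * n + i.val) / q,
      Nat.div_lt_of_lt_mul ((classIndex_lt i r).trans_eq (h.trans (mul_comm p q)))⟩

/-- The position of a class vertex among the class vertices. -/
def classIndex : PartiteVertex m n p → ℕ
  | ⟨Sum.inl _, _⟩ => 0
  | ⟨Sum.inr i, r⟩ => r.val * n + i.val

/-- The class vertex of index `k` belongs to the special vertex `k / q`, which precedes it with no
other special vertex between; `p * q = m * n` makes every block full. -/
theorem mutualSepCount_wordKey_special {q : ℕ} (hq : 0 < q) (h : m * n = p * q) :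
    3 * mutualSepCount (keySign (wordKey q))
      (colorClass (partiteSet (m := m) (n := n) (p := p)) (Sum.inl 0))
      (univ.filter fun x => partiteSet x ≠ Sum.inl 0) =
      ((m : ℤ) * n) ^ 2 * ((p : ℤ) ^ 2 - 1) := by
  have hinj := wordKey_injective (m := m) (n := n) (p := p) hq
  have hσ := isOrderSign_keySign hinj univ
  have hcol := isPartiteColoring_partiteSet m n p
  have := hσ.mutualSepCount_eq (q := q) (ε := -1) (A := colorClass partiteSet (Sum.inl 0))
    (D := univ.filter fun x => partiteSet x ≠ Sum.inl 0)
    (disjoint_filter_filter_not _ _ _) (blockVertex h) ?_ ?_ ?_ ?_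
  · rwa [hcol.card_compl, hcol.card_special, Nat.cast_mul] at this
  · intro u hu
    obtain ⟨i, r, rfl⟩ := exists_eq_classVertex_of_ne (mem_filter.mp hu).2
    exact mem_colorClass.mpr rfl
  · intro a ha
    obtain ⟨s, rfl⟩ := exists_eq_specialVertex ha
    have hI : (Ico (s.val * q) (s.val * q + q)).card = q := by simp
    refine (card_nbij classIndex ?_ ?_ ?_).trans hI
    · intro u hu
      obtain ⟨hu1, hu2⟩ := mem_filter.mp hu
      obtain ⟨i, r, rfl⟩ := exists_eq_classVertex_of_ne (mem_filter.mp hu1).2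
      have e : (r.val * n + i.val) / q = s.val :=
        congrArg Fin.val (eq_of_heq (Sigma.mk.inj_iff.mp hu2).2)
      rw [Nat.div_eq_iff hq] at e
      simp only [coe_Ico, Set.mem_Ico]
      change s.val * q ≤ r.val * n + i.val ∧ r.val * n + i.val < s.val * q + q
      omega
    · intro u hu w hw e
      have hu := (mem_filter.mp (mem_filter.mp hu).1).2
      have hw := (mem_filter.mp (mem_filter.mp hw).1).2
      obtain ⟨i, r, rfl⟩ := exists_eq_classVertex_of_ne hu
      obtain ⟨j, t, rfl⟩ := exists_eq_classVertex_of_ne hw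
      have e : r.val * n + i.val = t.val * n + j.val := e
      refine hinj ?_
      simp only [wordKey_classVertex, e]
    · intro k hk
      simp only [coe_Ico, Set.mem_Ico] at hk
      have hk' : k < m * n := by
        have : (s.val + 1) * q ≤ p * q := Nat.mul_le_mul_right q s.isLt
        rw [add_mul] at this
        omega
      have hn : 0 < n := Nat.pos_of_ne_zero fun e => by simp [e] at hk'
      have e : k / n * n + k % n = k := Nat.div_add_mod' k n
      refine ⟨classVertex p ⟨k % n, Nat.mod_lt _ hn⟩
        ⟨k / n, Nat.div_lt_of_lt_mul (by rwa [mul_comm])⟩, ?_, e⟩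
      rw [mem_coe, mem_filter]
      refine ⟨by simp, ?_⟩
      have : (k / n * n + k % n) / q = s.val := by
        rw [e, Nat.div_eq_iff hq]
        omega
      unfold blockVertex
      simp only [this]
  · intro u hu
    obtain ⟨i, r, rfl⟩ := exists_eq_classVertex_of_ne (mem_filter.mp hu).2
    refine keySign_of_lt ?_
    change 2 * (q * ((r.val * n + i.val) / q)) < 2 * (r.val * n + i.val) + 1
    have := Nat.mul_div_le (r.val * n + i.val) q
    omega
  · intro x hx u hu hne
    obtain ⟨s, rfl⟩ := exists_eq_specialVertex hx
    obtain ⟨i, r, rfl⟩ := exists_eq_classVertex_of_ne (mem_filter.mp hu).2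
    refine keySign_eq_of_lt_iff ?_
    change (2 * (q * s.val) < 2 * (r.val * n + i.val) + 1 ∧
      2 * (q * s.val) < 2 * (q * ((r.val * n + i.val) / q))) ∨
      (2 * (r.val * n + i.val) + 1 < 2 * (q * s.val) ∧
      2 * (q * ((r.val * n + i.val) / q)) < 2 * (q * s.val))
    have hne : (r.val * n + i.val) / q ≠ s.val := by
      intro e
      apply hne
      unfold blockVertex
      simp only [e]
    generalize r.val * n + i.val = k at hne ⊢
    have h1 := Nat.mul_div_le k q
    have h2 := Nat.lt_mul_div_succ k hq
    rcases lt_or_gt_of_ne hne with h | h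
    · have h3 : q * (k / q + 1) ≤ q * s.val := Nat.mul_le_mul_left q h
      rw [mul_add] at h2 h3
      omega
    · have h3 : q * (s.val + 1) ≤ q * (k / q) := Nat.mul_le_mul_left q h
      rw [mul_add] at h3
      omega

theorem three_mul_properSepSum_wordKey {q : ℕ} (hq : 0 < q) (h : m * n = p * q ∨ m * n = 0) :
    3 * properSepSum (keySign (wordKey (m := m) (n := n) (p := p) q)) partiteSet =
      crossingValue m n p := by
  have hinj := wordKey_injective (m := m) (n := n) (p := p) hq
  have hσ := isOrderSign_keySign hinj univ
  have hcol := isPartiteColoring_partiteSet m n p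
  have h1 := hcol.three_mul_properSepSum hσ
  have h2 := hcol.three_mul_variablePart_eq (σ := keySign (wordKey q)) ?_ ?_ ?_
  · linarith
  · rcases h with h | h
    · exact mutualSepCount_wordKey_special hq h
    · have hD := hcol.card_compl
      rw [h, card_eq_zero] at hD
      have h' : (m : ℤ) * n = 0 := by exact_mod_cast h
      rw [hD, h']
      simp [mutualSepCount]
  · rintro (i | i) hi (j | j) hj hij
    · exact absurd (congrArg Sum.inl (Subsingleton.elim i 0)) hi
    · exact absurd (congrArg Sum.inl (Subsingleton.elim i 0)) hi
    · exact absurd (congrArg Sum.inl (Subsingleton.elim j 0)) hj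
    · exact mutualSepCount_wordKey_class hq fun e => hij (by rw [e])
  · rintro v (i | i) hi (j | j) hj hij hvi hvj
    · exact absurd (congrArg Sum.inl (Subsingleton.elim i 0)) hi
    · exact absurd (congrArg Sum.inl (Subsingleton.elim i 0)) hi
    · exact absurd (congrArg Sum.inl (Subsingleton.elim j 0)) hj
    · exact sepCount_wordKey hq (fun e => hij (by rw [e])) v hvi hvj

end OptimalWord

/-! ### Crossing chords of the unit circle -/

section ChordGeometry

open Real

/-- The point of the unit circle at the angle `t`. -/
noncomputable def anglePoint (t : ℝ) : ℂ := (Circle.exp t : ℂ)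

theorem anglePoint_re (t : ℝ) : (anglePoint t).re = cos t := by
  simp [anglePoint, Circle.coe_exp, Complex.exp_ofReal_mul_I_re]

theorem anglePoint_im (t : ℝ) : (anglePoint t).im = sin t := by
  simp [anglePoint, Circle.coe_exp, Complex.exp_ofReal_mul_I_im]

/-- The sine of half the difference of two angles. -/
noncomputable def halfSin (x y : ℝ) : ℝ := sin ((x - y) / 2)

theorem halfSin_anti (x y : ℝ) : halfSin y x = -halfSin x y := by
  unfold halfSin
  rw [← sin_neg]
  ring_nf

@[simp] theorem halfSin_self (x : ℝ) : halfSin x x = 0 := by simp [halfSin]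

theorem halfSin_eq (x y : ℝ) :
    halfSin x y = sin (x / 2) * cos (y / 2) - cos (x / 2) * sin (y / 2) := by
  unfold halfSin
  rw [sub_div, sin_sub]

theorem halfSin_pos {x y : ℝ} (hx : x ∈ Set.Ioc (-π) π) (hy : y ∈ Set.Ioc (-π) π) (h : y < x) :
    0 < halfSin x y :=
  sin_pos_of_pos_of_lt_pi (by linarith) (by linarith [hx.2, hy.1])

theorem halfSin_ne_zero {x y : ℝ} (hx : x ∈ Set.Ioc (-π) π) (hy : y ∈ Set.Ioc (-π) π)
    (h : x ≠ y) : halfSin x y ≠ 0 := by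
  rcases lt_or_gt_of_ne h with h | h
  · rw [halfSin_anti]
    exact neg_ne_zero.mpr (halfSin_pos hy hx h).ne'
  · exact (halfSin_pos hx hy h).ne'

theorem halfSin_eq_keySign_mul {x y : ℝ} (hx : x ∈ Set.Ioc (-π) π) (hy : y ∈ Set.Ioc (-π) π) :
    halfSin x y = keySign id x y * |halfSin x y| := by
  rcases lt_trichotomy x y with h | rfl | h
  · have h1 := halfSin_pos hy hx h
    rw [keySign_of_lt (κ := id) h, halfSin_anti, abs_neg, abs_of_pos h1]
    simp
  · simp
  · rw [keySign_of_gt (κ := id) h, abs_of_pos (halfSin_pos hx hy h)]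
    simp

/-- The product of half sines that is negative exactly if the chords `a b` and `u v` cross. -/
noncomputable def sepSin (a b u v : ℝ) : ℝ :=
  halfSin a u * halfSin a v * halfSin b u * halfSin b v

theorem sepSin_neg_iff {a b u v : ℝ} (ha : a ∈ Set.Ioc (-π) π) (hb : b ∈ Set.Ioc (-π) π)
    (hu : u ∈ Set.Ioc (-π) π) (hv : v ∈ Set.Ioc (-π) π) :
    sepSin a b u v < 0 ↔ sepProd (keySign (id : ℝ → ℝ)) a b u v < 0 := by
  have e : sepSin a b u v = (sepProd (keySign (id : ℝ → ℝ)) a b u v : ℝ) *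
      (|halfSin a u| * |halfSin a v| * |halfSin b u| * |halfSin b v|) := by
    unfold sepSin sepProd
    conv_lhs => rw [halfSin_eq_keySign_mul ha hu, halfSin_eq_keySign_mul ha hv,
      halfSin_eq_keySign_mul hb hu, halfSin_eq_keySign_mul hb hv]
    push_cast
    ring
  rw [e]
  constructor
  · intro h
    by_contra hn
    have h1 : (0 : ℝ) ≤ sepProd (keySign (id : ℝ → ℝ)) a b u v := by exact_mod_cast not_lt.mp hn
    exact absurd h (not_lt.mpr (mul_nonneg h1 (by positivity)))
  · intro h
    have ne : a ≠ u ∧ a ≠ v ∧ b ≠ u ∧ b ≠ v := by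
      refine ⟨?_, ?_, ?_, ?_⟩ <;> rintro rfl <;> simp [sepProd] at h
    have h1 : (sepProd (keySign (id : ℝ → ℝ)) a b u v : ℝ) < 0 := by exact_mod_cast h
    refine mul_neg_of_neg_of_pos h1 ?_
    have := abs_pos.mpr (halfSin_ne_zero ha hu ne.1)
    have := abs_pos.mpr (halfSin_ne_zero ha hv ne.2.1)
    have := abs_pos.mpr (halfSin_ne_zero hb hu ne.2.2.1)
    have := abs_pos.mpr (halfSin_ne_zero hb hv ne.2.2.2)
    positivity

/-- An affine function that vanishes on the line through the points at the angles `a` and `b`. -/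
noncomputable def chordForm (a b : ℝ) (z : ℂ) : ℝ :=
  z.re * cos ((a + b) / 2) + z.im * sin ((a + b) / 2) - cos ((a - b) / 2)

/-- Makes the side of the chord `a b` on which a point of the circle lies readable from two half
sines. -/
theorem chordForm_anglePoint (a b t : ℝ) :
    chordForm a b (anglePoint t) = -2 * (halfSin t a * halfSin t b) := by
  unfold chordForm halfSin
  rw [anglePoint_re, anglePoint_im, ← cos_sub, cos_sub_cos]
  rw [show (t - (a + b) / 2 + (a - b) / 2) / 2 = (t - b) / 2 by ring,
    show (t - (a + b) / 2 - (a - b) / 2) / 2 = (t - a) / 2 by ring]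
  ring

theorem chordForm_combination (a b : ℝ) {α β : ℝ} (h : α + β = 1) (z w : ℂ) :
    chordForm a b (α • z + β • w) = α * chordForm a b z + β * chordForm a b w := by
  unfold chordForm
  simp only [Complex.add_re, Complex.add_im, Complex.real_smul, Complex.re_ofReal_mul,
    Complex.im_ofReal_mul]
  linear_combination cos ((a - b) / 2) * h

theorem chordForm_eq_zero {a b : ℝ} {z : ℂ}
    (hz : z ∈ openSegment ℝ (anglePoint a) (anglePoint b)) : chordForm a b z = 0 := by
  obtain ⟨α, β, -, -, h, rfl⟩ := hz
  rw [chordForm_combination a b h, chordForm_anglePoint, chordForm_anglePoint]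
  simp

theorem sepSin_eq (a b u v : ℝ) :
    sepSin a b u v = (halfSin u a * halfSin u b) * (halfSin v a * halfSin v b) := by
  unfold sepSin
  rw [halfSin_anti u a, halfSin_anti u b, halfSin_anti v a, halfSin_anti v b]
  ring

/-- The form of the chord `a b` vanishes at `z`, a positive combination of its values at `u` and
`v`. Hence these have opposite signs, or both vanish, and then `u, v` would be the ends `a, b`. -/
theorem sepSin_neg_of_mem {a b u v : ℝ} {z : ℂ} (ha : a ∈ Set.Ioc (-π) π)
    (hb : b ∈ Set.Ioc (-π) π) (hu : u ∈ Set.Ioc (-π) π) (hv : v ∈ Set.Ioc (-π) π)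
    (huv : u ≠ v) (hne : s(a, b) ≠ s(u, v))
    (hz : z ∈ openSegment ℝ (anglePoint a) (anglePoint b))
    (hz' : z ∈ openSegment ℝ (anglePoint u) (anglePoint v)) : sepSin a b u v < 0 := by
  have h0 := chordForm_eq_zero hz
  obtain ⟨α, β, hα, hβ, h, rfl⟩ := hz'
  rw [chordForm_combination a b h, chordForm_anglePoint, chordForm_anglePoint] at h0
  rw [sepSin_eq]
  set P := halfSin u a * halfSin u b
  set Q := halfSin v a * halfSin v b
  have h1 : α * P + β * Q = 0 := by linarith
  rcases lt_trichotomy P 0 with hP | hP | hP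
  · refine mul_neg_of_neg_of_pos hP ?_
    by_contra hQ
    nlinarith [mul_neg_of_pos_of_neg hα hP, mul_nonpos_of_nonneg_of_nonpos hβ.le (not_lt.mp hQ)]
  · exfalso
    have hQ : Q = 0 := by
      rw [hP, mul_zero, zero_add] at h1
      exact (mul_eq_zero.mp h1).resolve_left hβ.ne'
    have endpoint : ∀ t ∈ Set.Ioc (-π) π, halfSin t a * halfSin t b = 0 → t = a ∨ t = b := by
      intro t ht h
      by_contra hn
      push Not at hn
      exact mul_ne_zero (halfSin_ne_zero ht ha hn.1) (halfSin_ne_zero ht hb hn.2) h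
    rcases endpoint u hu hP with rfl | rfl <;> rcases endpoint v hv hQ with rfl | rfl
    · exact huv rfl
    · exact hne rfl
    · exact hne Sym2.eq_swap
    · exact huv rfl
  · refine mul_neg_of_pos_of_neg hP ?_
    by_contra hQ
    nlinarith [mul_pos hα hP, mul_nonneg hβ.le (not_lt.mp hQ)]

/-- The linear relation among the values at four angles of a quadratic form in `cos (t / 2)` and
`sin (t / 2)`. The three monomials yield 1, `cos t` and `sin t`, so it is the affine relation of the
four points on the circle. -/
theorem halfSin_quadratic_identity (g : ℝ → ℝ → ℝ) (a b u v : ℝ)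
    (hg : g = (fun c _ => c ^ 2) ∨ g = (fun c s => s * c) ∨ g = (fun _ s => s ^ 2)) :
    halfSin a b * (halfSin v a * halfSin v b * g (cos (u / 2)) (sin (u / 2)) -
      halfSin u a * halfSin u b * g (cos (v / 2)) (sin (v / 2))) =
    -halfSin u v * (halfSin b u * halfSin b v * g (cos (a / 2)) (sin (a / 2)) -
      halfSin a u * halfSin a v * g (cos (b / 2)) (sin (b / 2))) := by
  simp only [halfSin_eq]
  rcases hg with rfl | rfl | rfl <;> ring

/-- Opposite signs give positive weights on each chord, and the affine relation shows that the two
weighted points coincide. -/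
theorem exists_mem_of_sepSin_neg {a b u v : ℝ} (h : sepSin a b u v < 0) (hab : halfSin a b ≠ 0)
    (huv : halfSin u v ≠ 0) : ∃ z, z ∈ openSegment ℝ (anglePoint a) (anglePoint b) ∧
      z ∈ openSegment ℝ (anglePoint u) (anglePoint v) := by
  have h1 := sepSin_eq a b u v ▸ h
  have h2 : halfSin a u * halfSin a v * (halfSin b u * halfSin b v) < 0 := by
    unfold sepSin at h
    linarith
  have i1 := halfSin_quadratic_identity (fun c _ => c ^ 2) a b u v (Or.inl rfl)
  have i2 := halfSin_quadratic_identity (fun c s => s * c) a b u v (Or.inr (Or.inl rfl))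
  have i3 := halfSin_quadratic_identity (fun _ s => s ^ 2) a b u v (Or.inr (Or.inr rfl))
  set P := halfSin u a * halfSin u b
  set Q := halfSin v a * halfSin v b
  set R := halfSin a u * halfSin a v
  set S := halfSin b u * halfSin b v
  have weights : ∀ X Y : ℝ, X * Y < 0 → 0 < Y / (Y - X) ∧ 0 < -X / (Y - X) ∧ Y - X ≠ 0 := by
    intro X Y hXY
    rcases mul_neg_iff.mp hXY with ⟨hX, hY⟩ | ⟨hX, hY⟩
    · have : Y - X < 0 := by linarith
      exact ⟨div_pos_of_neg_of_neg hY this, div_pos_of_neg_of_neg (by linarith) this, this.ne⟩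
    · have : 0 < Y - X := by linarith
      exact ⟨div_pos hY this, div_pos (by linarith) this, this.ne'⟩
  obtain ⟨w1, w2, w3⟩ := weights P Q h1
  obtain ⟨w4, w5, w6⟩ := weights R S h2
  have one : ∀ t : ℝ, cos (t / 2) ^ 2 + sin (t / 2) ^ 2 = 1 := fun t => cos_sq_add_sin_sq _
  have hcos : ∀ t : ℝ, cos t = cos (t / 2) ^ 2 - sin (t / 2) ^ 2 := fun t => by
    rw [← cos_two_mul', mul_div_cancel₀ _ two_ne_zero]
  have hsin : ∀ t : ℝ, sin t = 2 * (sin (t / 2) * cos (t / 2)) := fun t => by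
    rw [← mul_assoc, ← sin_two_mul, mul_div_cancel₀ _ two_ne_zero]
  have j1 : halfSin a b * (Q - P) = -halfSin u v * (S - R) := by
    linear_combination i1 + i3 - halfSin a b * Q * one u + halfSin a b * P * one v
      - halfSin u v * S * one a + halfSin u v * R * one b
  have j2 : halfSin a b * (Q * cos u - P * cos v) = -halfSin u v * (S * cos a - R * cos b) := by
    rw [hcos u, hcos v, hcos a, hcos b]
    linear_combination i1 - i3
  have j3 : halfSin a b * (Q * sin u - P * sin v) = -halfSin u v * (S * sin a - R * sin b) := by
    rw [hsin u, hsin v, hsin a, hsin b]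
    linear_combination 2 * i2
  have transfer : ∀ X Y : ℝ, halfSin a b * X = -halfSin u v * Y → Y / (S - R) = X / (Q - P) := by
    intro X Y hXY
    rw [div_eq_div_iff w6 w3]
    have : halfSin a b * halfSin u v * (Y * (Q - P) - X * (S - R)) = 0 := by
      linear_combination halfSin u v * Y * j1 - halfSin u v * (S - R) * hXY
    have := (mul_eq_zero.mp this).resolve_left (mul_ne_zero hab huv)
    linarith
  refine ⟨(S / (S - R)) • anglePoint a + (-R / (S - R)) • anglePoint b,
    ⟨_, _, w4, w5, by field_simp; ring, rfl⟩, ⟨_, _, w1, w2, by field_simp; ring, ?_⟩⟩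
  apply Complex.ext
  · simp only [Complex.add_re, Complex.real_smul, Complex.re_ofReal_mul, anglePoint_re]
    have := transfer _ _ j2
    rw [sub_div, sub_div] at this
    linear_combination -this
  · simp only [Complex.add_im, Complex.real_smul, Complex.im_ofReal_mul, anglePoint_im]
    have := transfer _ _ j3
    rw [sub_div, sub_div] at this
    linear_combination -this

/-- The form of `a b` is affine along `u v` with values of opposite sign at the ends, so it vanishes
only once. -/
theorem eq_of_mem_chords {a b u v : ℝ} {z w : ℂ} (ha : a ∈ Set.Ioc (-π) π)
    (hb : b ∈ Set.Ioc (-π) π) (hu : u ∈ Set.Ioc (-π) π) (hv : v ∈ Set.Ioc (-π) π)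
    (huv : u ≠ v) (hne : s(a, b) ≠ s(u, v))
    (hz : z ∈ openSegment ℝ (anglePoint a) (anglePoint b))
    (hz' : z ∈ openSegment ℝ (anglePoint u) (anglePoint v))
    (hw : w ∈ openSegment ℝ (anglePoint a) (anglePoint b))
    (hw' : w ∈ openSegment ℝ (anglePoint u) (anglePoint v)) : z = w := by
  have hneg := sepSin_neg_of_mem ha hb hu hv huv hne hz hz'
  have z0 := chordForm_eq_zero hz
  have w0 := chordForm_eq_zero hw
  obtain ⟨α, β, -, -, h, rfl⟩ := hz'
  obtain ⟨γ, δ, -, -, h', rfl⟩ := hw'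
  rw [chordForm_combination a b h, chordForm_anglePoint, chordForm_anglePoint] at z0
  rw [chordForm_combination a b h', chordForm_anglePoint, chordForm_anglePoint] at w0
  rw [sepSin_eq] at hneg
  set P := halfSin u a * halfSin u b
  set Q := halfSin v a * halfSin v b
  have hPQ : P - Q ≠ 0 := fun e => by
    rw [sub_eq_zero.mp e] at hneg
    exact absurd hneg (not_lt.mpr (mul_self_nonneg Q))
  have hβ : β = 1 - α := by linarith
  have hδ : δ = 1 - γ := by linarith
  subst hβ hδ
  have : (α - γ) * (P - Q) = 0 := by linear_combination (w0 - z0) / 2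
  have : α = γ := sub_eq_zero.mp ((mul_eq_zero.mp this).resolve_right hPQ)
  rw [this]

end ChordGeometry

/-! ### From drawings to sign counts -/

section CrossingCount

open Finset

variable {V : Type*}

/-- Handshake counting for the graph whose edges are the pairs with `P`. -/
theorem two_mul_sum_sym2 [Fintype V] [DecidableEq V] (P : Sym2 V → Prop) [DecidablePred P]
    (hP : ∀ e, P e → ¬ e.IsDiag) :
    ∑ x, ∑ y, (if P s(x, y) then 1 else 0) = 2 * ∑ e, (if P e then 1 else 0) := by
  classical
  have h := SimpleGraph.two_mul_card_edgeFinset (SimpleGraph.fromEdgeSet {e | P e})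
  have h1 : ∀ inst, @SimpleGraph.edgeFinset _ (SimpleGraph.fromEdgeSet {e | P e}) inst =
      univ.filter P := by
    intro inst
    ext e
    rw [SimpleGraph.mem_edgeFinset, SimpleGraph.edgeSet_fromEdgeSet]
    simp only [Set.mem_sdiff, Set.mem_ofPred_eq, mem_filter, mem_univ, true_and, and_iff_left_iff_imp]
    exact fun h => hP e h
  rw [h1, card_filter, card_filter] at h
  rw [h, Fintype.sum_prod_type]
  refine sum_congr rfl fun x _ => sum_congr rfl fun y _ => ?_
  congr 1
  change P s(x, y) = (SimpleGraph.fromEdgeSet {e | P e}).Adj x y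
  rw [SimpleGraph.fromEdgeSet_adj, eq_iff_iff, Set.mem_ofPred_eq]
  exact ⟨fun h => ⟨h, fun e => hP _ h (by simpa using e)⟩, fun h => h.1⟩

theorem edgeInterior_mk (pos : V → Circle) (x y : V) :
    edgeInterior pos s(x, y) = openSegment ℝ (pos x : ℂ) (pos y : ℂ) := by
  ext z
  constructor
  · rintro ⟨u, v, h, hz⟩
    rcases Sym2.eq_iff.mp h with ⟨rfl, rfl⟩ | ⟨rfl, rfl⟩
    · exact hz
    · rwa [openSegment_symm]
  · exact fun hz => ⟨x, y, rfl, hz⟩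

/-- The angle of a vertex. -/
noncomputable def angleKey (pos : V → Circle) (x : V) : ℝ := Complex.arg (pos x)

theorem angleKey_mem (pos : V → Circle) (x : V) : angleKey pos x ∈ Set.Ioc (-Real.pi) Real.pi :=
  Complex.arg_mem_Ioc _

theorem anglePoint_angleKey (pos : V → Circle) (x : V) : anglePoint (angleKey pos x) = pos x := by
  unfold anglePoint angleKey
  rw [Circle.exp_arg]

theorem angleKey_injective {pos : V → Circle} (h : pos.Injective) : (angleKey pos).Injective :=
  fun _ _ e => h (Circle.injective_arg e)

theorem edgeInterior_inter_nonempty_iff {pos : V → Circle} (h : pos.Injective) {x y u v : V}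
    (hxy : x ≠ y) (huv : u ≠ v) :
    s(x, y) ≠ s(u, v) ∧ (edgeInterior pos s(x, y) ∩ edgeInterior pos s(u, v)).Nonempty ↔
      sepProd (keySign (angleKey pos)) x y u v < 0 := by
  have hinj := angleKey_injective h
  have hiff := sepSin_neg_iff (angleKey_mem pos x) (angleKey_mem pos y) (angleKey_mem pos u)
    (angleKey_mem pos v)
  change _ ↔ sepProd (keySign (id : ℝ → ℝ)) (angleKey pos x) (angleKey pos y) (angleKey pos u)
    (angleKey pos v) < 0
  rw [← hiff, edgeInterior_mk, edgeInterior_mk]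
  simp only [← anglePoint_angleKey]
  constructor
  · rintro ⟨hne, z, hz, hz'⟩
    refine sepSin_neg_of_mem (angleKey_mem pos x) (angleKey_mem pos y) (angleKey_mem pos u)
      (angleKey_mem pos v) (hinj.ne huv) ?_ hz hz'
    intro e
    exact hne (Sym2.map.injective hinj e)
  · intro hneg
    constructor
    · intro e
      rcases Sym2.eq_iff.mp e with ⟨rfl, rfl⟩ | ⟨rfl, rfl⟩ <;> simp [sepSin] at hneg
    · obtain ⟨z, hz, hz'⟩ := exists_mem_of_sepSin_neg hneg
        (halfSin_ne_zero (angleKey_mem pos x) (angleKey_mem pos y) (hinj.ne hxy))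
        (halfSin_ne_zero (angleKey_mem pos u) (angleKey_mem pos v) (hinj.ne huv))
      exact ⟨z, hz, hz'⟩

variable {G : SimpleGraph V}

/-- The graph on the pairs of vertices whose edges are the crossings of a drawing. -/
def OuterplanarDrawing.crossingGraph (D : OuterplanarDrawing G) : SimpleGraph (Sym2 V) where
  Adj e f := e ∈ G.edgeSet ∧ f ∈ G.edgeSet ∧ e ≠ f ∧
    (edgeInterior D.pos e ∩ edgeInterior D.pos f).Nonempty
  symm.symm e f h := ⟨h.2.1, h.1, h.2.2.1.symm, by rw [Set.inter_comm]; exact h.2.2.2⟩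
  loopless.irrefl e h := h.2.2.1 rfl

theorem OuterplanarDrawing.crossings_eq (D : OuterplanarDrawing G) :
    D.crossings = D.crossingGraph.edgeSet := by
  ext q
  induction q with | _ e f
  rw [SimpleGraph.mem_edgeSet]
  constructor
  · rintro ⟨e', he, f', hf, hne, hq, hint⟩
    have : D.crossingGraph.Adj e' f' := ⟨he, hf, hne, hint⟩
    rw [← SimpleGraph.mem_edgeSet] at this ⊢
    rwa [hq]
  · rintro ⟨he, hf, hne, hint⟩
    exact ⟨e, he, f, hf, hne, rfl, hint⟩

theorem OuterplanarDrawing.crossingGraph_adj (D : OuterplanarDrawing G) (x y u v : V) :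
    D.crossingGraph.Adj s(x, y) s(u, v) ↔
      G.Adj x y ∧ G.Adj u v ∧ sepProd (keySign (angleKey D.pos)) x y u v < 0 := by
  constructor
  · rintro ⟨he, hf, h⟩
    rw [SimpleGraph.mem_edgeSet] at he hf
    exact ⟨he, hf, (edgeInterior_inter_nonempty_iff D.pos_injective he.ne hf.ne).mp h⟩
  · rintro ⟨he, hf, h⟩
    exact ⟨he, hf, (edgeInterior_inter_nonempty_iff D.pos_injective he.ne hf.ne).mpr h⟩

/-- A factor 2 for ordering each of the two edges and one for ordering the pair of edges. -/
theorem OuterplanarDrawing.eight_mul_cr [Fintype V] [DecidableEq V] (D : OuterplanarDrawing G)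
    [DecidableRel G.Adj] :
    8 * D.cr = ∑ x, ∑ y, ∑ u, ∑ v, if G.Adj x y ∧ G.Adj u v ∧
      sepProd (keySign (angleKey D.pos)) x y u v < 0 then 1 else 0 := by
  classical
  have h1 : 2 * D.cr = ∑ e, ∑ f, if D.crossingGraph.Adj e f then 1 else 0 := by
    have := SimpleGraph.two_mul_card_edgeFinset D.crossingGraph
    rw [card_filter, Fintype.sum_prod_type] at this
    rw [← this, OuterplanarDrawing.cr, D.crossings_eq, ← SimpleGraph.coe_edgeFinset,
      Set.ncard_coe_finset]
  have h2 : ∀ e, ∑ u, ∑ v, (if D.crossingGraph.Adj e s(u, v) then 1 else 0) =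
      2 * ∑ f, if D.crossingGraph.Adj e f then 1 else 0 := fun e =>
    two_mul_sum_sym2 (fun f => D.crossingGraph.Adj e f)
      fun f hf => SimpleGraph.not_isDiag_of_mem_edgeSet G hf.2.1
  have h3 : ∀ f, ∑ x, ∑ y, (if D.crossingGraph.Adj s(x, y) f then 1 else 0) =
      2 * ∑ e, if D.crossingGraph.Adj e f then 1 else 0 := fun f =>
    two_mul_sum_sym2 (fun e => D.crossingGraph.Adj e f)
      fun e he => SimpleGraph.not_isDiag_of_mem_edgeSet G he.1
  have h4 : ∑ x, ∑ y, ∑ f, (if D.crossingGraph.Adj s(x, y) f then 1 else 0) =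
      2 * ∑ e, ∑ f, if D.crossingGraph.Adj e f then 1 else 0 := by
    rw [sum_comm_cycle, sum_congr rfl fun f _ => h3 f, ← mul_sum, sum_comm]
  simp only [← D.crossingGraph_adj, h2, ← mul_sum]
  rw [h4, ← h1]
  ring

theorem OuterplanarDrawing.eight_mul_cr_eq_properSepSum {m n p : ℕ}
    (D : OuterplanarDrawing (multipartiteK p 1 m n)) :
    8 * (D.cr : ℤ) = properSepSum (keySign (angleKey D.pos))
      (partiteSet (m := m) (n := n) (p := p)) := by
  classical
  have hσ := isOrderSign_keySign (angleKey_injective D.pos_injective) univ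
  have h := D.eight_mul_cr
  have h' := congrArg (Nat.cast : ℕ → ℤ) h
  push_cast at h'
  rw [h']
  unfold properSepSum sepSum
  rw [sum_swap_pairs]
  refine sum_congr rfl fun x _ => sum_congr rfl fun y _ => ?_
  refine sum_congr rfl fun u _ => sum_congr rfl fun v _ => ?_
  rw [sep_comm_right]
  have hadj : ∀ a b, (multipartiteK p 1 m n).Adj a b ↔ partiteSet a ≠ partiteSet b :=
    fun a b => Iff.rfl
  have hadj' : partiteSet y ≠ partiteSet x ↔ partiteSet x ≠ partiteSet y := ne_comm
  simp only [hadj, hadj', sep, indic]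
  by_cases h1 : partiteSet u = partiteSet v
  · simp [h1]
  · by_cases h2 : partiteSet x = partiteSet y
    · simp [h2]
    · simp [h1, h2]

end CrossingCount

/-! ### Points on the circle without three concurrent chords -/

section GeneralPosition

open Real

/-- The chords between the first `N` points are in general position, and these points are
in counterclockwise order on the upper half circle. -/
structure IsGeneralUpTo (θ : ℕ → ℝ) (N : ℕ) : Prop where
  mem : ∀ k < N, θ k ∈ Set.Ioo 0 π
  lt : ∀ k l, k < l → l < N → θ k < θ l
  inter : ∀ e f g : Sym2 ℕ, (∀ k ∈ e, k < N) → (∀ k ∈ f, k < N) → (∀ k ∈ g, k < N) →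
    ¬ e.IsDiag → ¬ f.IsDiag → ¬ g.IsDiag → e ≠ f → e ≠ g → f ≠ g →
    edgeInterior (fun k => Circle.exp (θ k)) e ∩ edgeInterior (fun k => Circle.exp (θ k)) f ∩
      edgeInterior (fun k => Circle.exp (θ k)) g = ∅

theorem edgeInterior_exp (θ : ℕ → ℝ) (x y : ℕ) :
    edgeInterior (fun k => Circle.exp (θ k)) s(x, y) =
      openSegment ℝ (anglePoint (θ x)) (anglePoint (θ y)) :=
  edgeInterior_mk _ x y

theorem mem_Ioc_of_mem_Ioo {t : ℝ} (h : t ∈ Set.Ioo 0 π) : t ∈ Set.Ioc (-π) π :=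
  ⟨by linarith [h.1, pi_pos], h.2.le⟩

/-- The angles `t` for which the chord from `t` to `y` passes through a crossing of the chords
`a b` and `c d`. -/
def concurrentAngles (a b c d y : ℝ) : Set ℝ :=
  {t | t ∈ Set.Ioo 0 π ∧ t ≠ y ∧ ∃ z, z ∈ openSegment ℝ (anglePoint a) (anglePoint b) ∧
    z ∈ openSegment ℝ (anglePoint c) (anglePoint d) ∧
    z ∈ openSegment ℝ (anglePoint t) (anglePoint y)}

/-- A common interior point would make `sepSin` negative, but the shared end gives it a zero factor.
-/
theorem disjoint_of_common_endpoint {t t' y : ℝ} (ht : t ∈ Set.Ioc (-π) π)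
    (ht' : t' ∈ Set.Ioc (-π) π) (hy : y ∈ Set.Ioc (-π) π) (hty : t' ≠ y)
    (htt : t ≠ t') {z : ℂ} (hz : z ∈ openSegment ℝ (anglePoint t) (anglePoint y)) :
    z ∉ openSegment ℝ (anglePoint t') (anglePoint y) := by
  intro hz'
  have hne : s(t, y) ≠ s(t', y) := by
    intro e
    rcases Sym2.eq_iff.mp e with ⟨h, -⟩ | ⟨h, h'⟩
    · exact htt h
    · exact hty h'.symm
  have := sepSin_neg_of_mem ht hy ht' hy hty hne hz hz'
  simp [sepSin] at this

/-- The two chords meet in at most one point, and through it passes at most one chord that ends at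
`y`. -/
theorem concurrentAngles_subsingleton {a b c d y : ℝ} (ha : a ∈ Set.Ioo 0 π)
    (hb : b ∈ Set.Ioo 0 π) (hc : c ∈ Set.Ioo 0 π) (hd : d ∈ Set.Ioo 0 π) (hy : y ∈ Set.Ioo 0 π)
    (hcd : c ≠ d) (hne : s(a, b) ≠ s(c, d)) :
    (concurrentAngles a b c d y).Subsingleton := by
  rintro t ⟨ht, hty, z, hz1, hz2, hz3⟩ t' ⟨ht', hty', z', hz1', hz2', hz3'⟩
  have hzz := eq_of_mem_chords (mem_Ioc_of_mem_Ioo ha) (mem_Ioc_of_mem_Ioo hb)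
    (mem_Ioc_of_mem_Ioo hc) (mem_Ioc_of_mem_Ioo hd) hcd hne hz1 hz2 hz1' hz2'
  subst hzz
  by_contra htt
  exact disjoint_of_common_endpoint (mem_Ioc_of_mem_Ioo ht) (mem_Ioc_of_mem_Ioo ht')
    (mem_Ioc_of_mem_Ioo hy) hty' htt hz3 hz3'

theorem IsGeneralUpTo.injOn {θ : ℕ → ℝ} {N k l : ℕ} (h : IsGeneralUpTo θ N) (hk : k < N)
    (hl : l < N) (e : θ k = θ l) : k = l := by
  rcases lt_trichotomy k l with hkl | hkl | hkl
  · exact absurd e (h.lt k l hkl hl).ne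
  · exact hkl
  · exact absurd e (h.lt l k hkl hk).ne'

theorem IsGeneralUpTo.exists_upper {θ : ℕ → ℝ} {N : ℕ} (h : IsGeneralUpTo θ N) :
    ∃ M, 0 ≤ M ∧ M < π ∧ ∀ k < N, θ k ≤ M := by
  rcases N with _ | N
  · exact ⟨0, le_rfl, pi_pos, fun k hk => absurd hk (Nat.not_lt_zero k)⟩
  · have hN := h.mem N (Nat.lt_succ_self N)
    refine ⟨θ N, hN.1.le, hN.2, fun k hk => ?_⟩
    rcases (Nat.lt_succ_iff.mp hk).lt_or_eq with hk' | rfl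
    · exact (h.lt k N hk' (Nat.lt_succ_self N)).le
    · exact le_rfl

/-- Only finitely many angles are bad, while the interval between the last angle and `π` is
infinite. -/
theorem IsGeneralUpTo.exists_next {θ : ℕ → ℝ} {N : ℕ} (h : IsGeneralUpTo θ N) :
    ∃ t ∈ Set.Ioo 0 π, (∀ k < N, θ k < t) ∧ ∀ a < N, ∀ b < N, ∀ c < N, ∀ d < N, ∀ y < N,
      c ≠ d → s(a, b) ≠ s(c, d) → t ∉ concurrentAngles (θ a) (θ b) (θ c) (θ d) (θ y) := by
  obtain ⟨M, hM0, hMpi, hM⟩ := h.exists_upper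
  set bad : Set ℝ := ⋃ a ∈ Set.Iio N, ⋃ b ∈ Set.Iio N, ⋃ c ∈ Set.Iio N, ⋃ d ∈ Set.Iio N,
    ⋃ y ∈ Set.Iio N, {t | c ≠ d ∧ s(a, b) ≠ s(c, d) ∧
      t ∈ concurrentAngles (θ a) (θ b) (θ c) (θ d) (θ y)} with hbad
  have hfin : bad.Finite := by
    refine (Set.finite_Iio N).biUnion fun a ha => (Set.finite_Iio N).biUnion fun b hb =>
      (Set.finite_Iio N).biUnion fun c hc => (Set.finite_Iio N).biUnion fun d hd =>
      (Set.finite_Iio N).biUnion fun y hy => ?_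
    by_cases hcd : c ≠ d ∧ s(a, b) ≠ s(c, d)
    · refine ((concurrentAngles_subsingleton (h.mem a ha) (h.mem b hb) (h.mem c hc) (h.mem d hd)
        (h.mem y hy) (fun e => hcd.1 (h.injOn hc hd e)) ?_).finite).subset fun t ht => ht.2.2
      intro e
      apply hcd.2
      rcases Sym2.eq_iff.mp e with ⟨h1, h2⟩ | ⟨h1, h2⟩
      · rw [h.injOn ha hc h1, h.injOn hb hd h2]
      · rw [h.injOn ha hd h1, h.injOn hb hc h2, Sym2.eq_swap]
    · exact Set.finite_empty.subset fun t ht => hcd ⟨ht.1, ht.2.1⟩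
  obtain ⟨t, ⟨ht1, ht2⟩, htb⟩ := ((Set.Ioo_infinite hMpi).sdiff hfin).nonempty
  refine ⟨t, ⟨hM0.trans_lt ht1, ht2⟩, fun k hk => (hM k hk).trans_lt ht1, ?_⟩
  intro a ha b hb c hc d hd y hy hcd hne hmem
  apply htb
  simp only [hbad, Set.mem_iUnion]
  exact ⟨a, ha, b, hb, c, hc, d, hd, y, hy, hcd, hne, hmem⟩

theorem edgeInterior_congr {V : Type*} {pos pos' : V → Circle} {e : Sym2 V}
    (h : ∀ x ∈ e, pos x = pos' x) : edgeInterior pos e = edgeInterior pos' e := by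
  induction e with | _ x y
  rw [edgeInterior_mk, edgeInterior_mk, h x (by simp), h y (by simp)]

theorem IsGeneralUpTo.succ {θ : ℕ → ℝ} {N : ℕ} (h : IsGeneralUpTo θ N) :
    ∃ θ', IsGeneralUpTo θ' (N + 1) := by
  obtain ⟨t, ht, hlt, havoid⟩ := h.exists_next
  set θ' := Function.update θ N t with hθ'
  have old : ∀ k < N, θ' k = θ k := fun k hk => Function.update_of_ne hk.ne _ _
  have new : θ' N = t := Function.update_self _ _ _
  have hmem : ∀ k < N + 1, θ' k ∈ Set.Ioo 0 π := by
    intro k hk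
    rcases (Nat.lt_succ_iff.mp hk).lt_or_eq with hk | rfl
    · rw [old k hk]
      exact h.mem k hk
    · rwa [new]
  have hmono : ∀ k l, k < l → l < N + 1 → θ' k < θ' l := by
    intro k l hkl hl
    rcases (Nat.lt_succ_iff.mp hl).lt_or_eq with hl | rfl
    · rw [old l hl, old k (hkl.trans hl)]
      exact h.lt k l hkl hl
    · rw [new, old k hkl]
      exact hlt k hkl
  have hinj : ∀ k < N + 1, ∀ l < N + 1, k ≠ l → θ' k ≠ θ' l := by
    intro k hk l hl hkl
    rcases lt_or_gt_of_ne hkl with h | h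
    · exact (hmono k l h hl).ne
    · exact (hmono l k h hk).ne'
  have below : ∀ e : Sym2 ℕ, (∀ k ∈ e, k < N + 1) → N ∉ e → ∀ k ∈ e, k < N := by
    intro e he hN k hk
    exact lt_of_le_of_ne (Nat.lt_succ_iff.mp (he k hk)) fun e' => hN (e' ▸ hk)
  have oldEdge : ∀ e : Sym2 ℕ, (∀ k ∈ e, k < N) →
      edgeInterior (fun k => Circle.exp (θ' k)) e = edgeInterior (fun k => Circle.exp (θ k)) e :=
    fun e he => edgeInterior_congr fun k hk => by rw [old k (he k hk)]
  -- Two chords from the new point have disjoint interiors, so only triples with exactly one new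
  -- chord (`single`) need the choice of `t`.
  have shared : ∀ e f : Sym2 ℕ, (∀ k ∈ e, k < N + 1) → (∀ k ∈ f, k < N + 1) → ¬ e.IsDiag →
      ¬ f.IsDiag → e ≠ f → N ∈ e → N ∈ f →
      edgeInterior (fun k => Circle.exp (θ' k)) e ∩
        edgeInterior (fun k => Circle.exp (θ' k)) f = ∅ := by
    intro e f he hf hed hfd hef hNe hNf
    obtain ⟨x, rfl⟩ := Sym2.mem_iff_exists.mp hNe
    obtain ⟨y, rfl⟩ := Sym2.mem_iff_exists.mp hNf
    rw [Set.eq_empty_iff_forall_notMem]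
    rintro z ⟨hz, hz'⟩
    rw [edgeInterior_exp, openSegment_symm] at hz hz'
    have hx := he x (by simp)
    have hy := hf y (by simp)
    refine disjoint_of_common_endpoint (mem_Ioc_of_mem_Ioo (hmem x hx))
      (mem_Ioc_of_mem_Ioo (hmem y hy)) (mem_Ioc_of_mem_Ioo (hmem N (Nat.lt_succ_self N)))
      (hinj y hy N (Nat.lt_succ_self N) ?_) (hinj x hx y hy ?_) hz hz'
    · rintro rfl
      exact hfd (by simp)
    · rintro rfl
      exact hef rfl
  have single : ∀ e f g : Sym2 ℕ, (∀ k ∈ e, k < N) → (∀ k ∈ f, k < N) → (∀ k ∈ g, k < N + 1) →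
      ¬ f.IsDiag → ¬ g.IsDiag → e ≠ f → N ∈ g →
      edgeInterior (fun k => Circle.exp (θ' k)) e ∩ edgeInterior (fun k => Circle.exp (θ' k)) f ∩
        edgeInterior (fun k => Circle.exp (θ' k)) g = ∅ := by
    intro e f g he hf hg hfd hgd hef hNg
    obtain ⟨y, rfl⟩ := Sym2.mem_iff_exists.mp hNg
    induction e with | _ a b
    induction f with | _ c d
    rw [Set.eq_empty_iff_forall_notMem]
    rintro z ⟨⟨hz1, hz2⟩, hz3⟩
    have hyN : y ≠ N := by
      rintro rfl
      exact hgd (by simp)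
    have hy : y < N := lt_of_le_of_ne (Nat.lt_succ_iff.mp (hg y (by simp))) hyN
    rw [oldEdge _ he, edgeInterior_exp] at hz1
    rw [oldEdge _ hf, edgeInterior_exp] at hz2
    rw [edgeInterior_exp, new, old y hy] at hz3
    exact havoid a (he a (by simp)) b (he b (by simp)) c (hf c (by simp)) d (hf d (by simp)) y hy
      (by simpa using hfd) hef ⟨ht, (hlt y hy).ne', z, hz1, hz2, hz3⟩
  refine ⟨θ', hmem, hmono, ?_⟩
  intro e f g he hf hg hed hfd hgd hef heg hfg
  by_cases hNe : N ∈ e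
  · by_cases hNf : N ∈ f
    · rw [shared e f he hf hed hfd hef hNe hNf, Set.empty_inter]
    · by_cases hNg : N ∈ g
      · rw [Set.inter_right_comm, shared e g he hg hed hgd heg hNe hNg, Set.empty_inter]
      · rw [Set.inter_assoc, Set.inter_comm]
        exact single f g e (below f hf hNf) (below g hg hNg) he hgd hed hfg hNe
  · by_cases hNf : N ∈ f
    · by_cases hNg : N ∈ g
      · rw [Set.inter_assoc, shared f g hf hg hfd hgd hfg hNf hNg, Set.inter_empty]
      · rw [Set.inter_right_comm]
        exact single e g f (below e he hNe) (below g hg hNg) hf hgd hfd heg hNf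
    · by_cases hNg : N ∈ g
      · exact single e f g (below e he hNe) (below f hf hNf) hg hfd hgd hef hNg
      · rw [oldEdge e (below e he hNe), oldEdge f (below f hf hNf), oldEdge g (below g hg hNg)]
        exact h.inter e f g (below e he hNe) (below f hf hNf) (below g hg hNg) hed hfd hgd hef heg
          hfg

theorem exists_isGeneralUpTo (N : ℕ) : ∃ θ, IsGeneralUpTo θ N := by
  induction N with
  | zero =>
    refine ⟨fun _ => 0, ⟨fun k hk => absurd hk (Nat.not_lt_zero k),
      fun k l _ hl => absurd hl (Nat.not_lt_zero l), ?_⟩⟩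
    intro e f g he
    induction e with | _ a b
    exact absurd (he a (by simp)) (Nat.not_lt_zero a)
  | succ N ih =>
    obtain ⟨θ, hθ⟩ := ih
    exact hθ.succ

theorem edgeInterior_map {V W : Type*} (pos : W → Circle) (κ : V → W) (e : Sym2 V) :
    edgeInterior (pos ∘ κ) e = edgeInterior pos (e.map κ) := by
  induction e with | _ x y
  rw [Sym2.map_mk, edgeInterior_mk, edgeInterior_mk]
  rfl

/-- Every linear order of the vertices is realized by a drawing. -/
theorem exists_outerplanarDrawing {V : Type*} [Finite V] (G : SimpleGraph V) {κ : V → ℕ}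
    (hκ : κ.Injective) :
    ∃ D : OuterplanarDrawing G, ∀ x y, angleKey D.pos x < angleKey D.pos y ↔ κ x < κ y := by
  obtain ⟨N, hN⟩ : ∃ N, ∀ x, κ x < N := by
    obtain ⟨M, hM⟩ := (Set.finite_range κ).bddAbove
    exact ⟨M + 1, fun x => Nat.lt_succ_of_le (hM ⟨x, rfl⟩)⟩
  obtain ⟨θ, hθ⟩ := exists_isGeneralUpTo N
  -- Angles in `(0, π)` are recovered by `Complex.arg`, so the drawing keeps the prescribed order.
  have harg : ∀ x, angleKey ((fun k => Circle.exp (θ k)) ∘ κ) x = θ (κ x) := by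
    intro x
    have := mem_Ioc_of_mem_Ioo (hθ.mem _ (hN x))
    exact Circle.arg_exp this.1 this.2
  have hlt : ∀ x y, θ (κ x) < θ (κ y) ↔ κ x < κ y := by
    intro x y
    constructor
    · intro h
      by_contra hn
      rcases (not_lt.mp hn).lt_or_eq with h' | h'
      · exact absurd h (not_lt.mpr (hθ.lt _ _ h' (hN x)).le)
      · rw [h'] at h
        exact lt_irrefl _ h
    · exact fun h => hθ.lt _ _ h (hN y)
  refine ⟨⟨(fun k => Circle.exp (θ k)) ∘ κ, ?_, ?_⟩, ?_⟩
  · intro x y hxy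
    have : θ (κ x) = θ (κ y) := by
      rw [← harg, ← harg]
      exact congrArg (fun z : Circle => Complex.arg z) hxy
    exact hκ (hθ.injOn (hN x) (hN y) this)
  · have hmap := Sym2.map.injective hκ
    have hbound : ∀ e : Sym2 V, ∀ k ∈ e.map κ, k < N := by
      intro e k hk
      obtain ⟨x, -, rfl⟩ := Sym2.mem_map.mp hk
      exact hN x
    have hdiag : ∀ e ∈ G.edgeSet, ¬ (e.map κ).IsDiag := by
      intro e he hd
      induction e with | _ x y
      rw [Sym2.map_mk, Sym2.mk_isDiag_iff] at hd
      rw [SimpleGraph.mem_edgeSet] at he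
      exact he.ne (hκ hd)
    intro e he f hf g hg hef heg hfg
    rw [edgeInterior_map, edgeInterior_map, edgeInterior_map]
    exact hθ.inter _ _ _ (hbound e) (hbound f) (hbound g) (hdiag e he) (hdiag f hf) (hdiag g hg)
      (hmap.ne hef) (hmap.ne heg) (hmap.ne hfg)
  · intro x y
    change angleKey ((fun k => Circle.exp (θ k)) ∘ κ) x <
      angleKey ((fun k => Circle.exp (θ k)) ∘ κ) y ↔ _
    rw [harg, harg, hlt]

end GeneralPosition

/-! ### The crossing number -/

section CrossingNumber

theorem OuterplanarDrawing.crossingValue_le {m n p : ℕ} (h : p ∣ m * n)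
    (D : OuterplanarDrawing (multipartiteK p 1 m n)) :
    crossingValue m n p ≤ 24 * (D.cr : ℤ) := by
  classical
  have h1 := (isPartiteColoring_partiteSet m n p).crossingValue_le
    (isOrderSign_keySign (angleKey_injective D.pos_injective) Finset.univ) h
  rw [← D.eight_mul_cr_eq_properSepSum] at h1
  linarith

theorem exists_optimal_drawing {m n p : ℕ} (h : p ∣ m * n) :
    ∃ D : OuterplanarDrawing (multipartiteK p 1 m n), 24 * (D.cr : ℤ) = crossingValue m n p := by
  -- If the quotient is 0, there are no class vertices; `q = 1` then merely keeps the special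
  -- vertices distinct.
  obtain ⟨q, hq, hqp⟩ : ∃ q, 0 < q ∧ (m * n = p * q ∨ m * n = 0) := by
    obtain ⟨q, hq⟩ := h
    rcases Nat.eq_zero_or_pos q with rfl | hq0
    · exact ⟨1, one_pos, Or.inr hq⟩
    · exact ⟨q, hq0, Or.inl hq⟩
  obtain ⟨D, hD⟩ := exists_outerplanarDrawing (multipartiteK p 1 m n)
    (wordKey_injective (m := m) (n := n) (p := p) hq)
  refine ⟨D, ?_⟩
  have hsign : keySign (angleKey D.pos) = keySign (wordKey (m := m) (n := n) (p := p) q) := by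
    funext x y
    simp only [keySign, hD]
  have h1 := D.eight_mul_cr_eq_properSepSum
  have h2 := three_mul_properSepSum_wordKey (m := m) (n := n) (p := p) hq hqp
  rw [hsign] at h1
  linarith

theorem outerplanarCrossingNumber_multipartiteK {m n p : ℕ} (h : p ∣ m * n) :
    24 * (outerplanarCrossingNumber (multipartiteK p 1 m n) : ℤ) = crossingValue m n p := by
  obtain ⟨D, hD⟩ := exists_optimal_drawing h
  have hle : outerplanarCrossingNumber (multipartiteK p 1 m n) ≤ D.cr := Nat.sInf_le ⟨D, rfl⟩
  obtain ⟨D', hD'⟩ : outerplanarCrossingNumber (multipartiteK p 1 m n) ∈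
      Set.range fun D : OuterplanarDrawing (multipartiteK p 1 m n) => D.cr :=
    Nat.sInf_mem ⟨D.cr, D, rfl⟩
  have h1 := D'.crossingValue_le h
  have h2 : (outerplanarCrossingNumber (multipartiteK p 1 m n) : ℤ) = D'.cr := by
    exact_mod_cast hD'.symm
  have h3 : (outerplanarCrossingNumber (multipartiteK p 1 m n) : ℤ) ≤ D.cr := by exact_mod_cast hle
  linarith

end CrossingNumber

theorem theorem1 (m n p : ℕ) (h : p ∣ m * n) :
    Nonempty (OuterplanarDrawing (multipartiteK p 1 m n)) ∧
    (outerplanarCrossingNumber (multipartiteK p 1 m n) : ℚ) =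
      1 / 24 * (m : ℚ) ^ 4 * (n : ℚ) ^ 4 + 1 / 12 * (m : ℚ) ^ 2 * (n : ℚ) ^ 3
      - 1 / 12 * (m : ℚ) ^ 4 * (n : ℚ) ^ 3 - 1 / 4 * (m : ℚ) ^ 3 * (n : ℚ) ^ 3
      + 1 / 2 * (m : ℚ) ^ 3 * (n : ℚ) ^ 2 + 1 / 24 * (m : ℚ) ^ 4 * (n : ℚ) ^ 2
      - 1 / 4 * (m : ℚ) ^ 3 * (n : ℚ)
      + 1 / 6 * (m : ℚ) ^ 2 * (n : ℚ) ^ 2 * (p : ℚ) ^ 2 - 1 / 4 * (p : ℚ) ^ 2 * (m : ℚ) * (n : ℚ)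
      - 3 / 4 * (m : ℚ) ^ 2 * (n : ℚ) ^ 2 * (p : ℚ)
      + 1 / 12 * (m : ℚ) * (n : ℚ) * (p : ℚ) + 1 / 2 * (m : ℚ) ^ 2 * (n : ℚ) * (p : ℚ)
      - 1 / 6 * (m : ℚ) ^ 3 * (n : ℚ) ^ 2 * (p : ℚ)
      + 1 / 6 * (m : ℚ) ^ 3 * (n : ℚ) ^ 3 * (p : ℚ)
      + 1 / 6 * (m : ℚ) * (n : ℚ) ^ 2 * (p : ℚ) := by
  obtain ⟨D, -⟩ := exists_optimal_drawing h
  refine ⟨⟨D⟩, ?_⟩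
  have h1 := congrArg (Int.cast : ℤ → ℚ) (outerplanarCrossingNumber_multipartiteK h)
  unfold crossingValue at h1
  push_cast at h1
  linear_combination h1 / 24
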